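/- Let $k$ and $E$ be number fields with $d=[E:\mathbb{Q}]$, and let $\mathcal{A}$ be an abelian variety over $k$ of dimension $d$ with an embedding $\phi\colon E\hookrightarrow \mathrm{End}_k(\mathcal{A})\otimes\mathbb{Q}$ (so that $\mathcal A$ is of $\mathrm{GL}_2$-type). Put $R=\{r\in\mathcal{O}_E : \phi(r)\in \mathrm{End}_k(\mathcal{A})\}$, where $\mathrm{End}_k(\mathcal A)$ is viewed inside $\mathrm{End}_k(\mathcal{A})\otimes\mathbb{Q}$. Let $p$ be a prime number that does not divide the index $[\mathcal{O}_E:R]$ and is unramified in $E$, let $\mathcal{P}$ be a prime ideal of $\mathcal{O}_E$ over $p$, and let $\mathbb{F}_q=\mathcal{O}_E/\mathcal{P}$. For $n\ge 0$ let $\mathcal{A}[\mathcal{P}^n]\simeq(\mathcal{O}_E/\mathcal{P}^n)^2$ be the group of $\bar k$-points of $\mathcal{A}$ killed by $\mathcal{P}^n\cap R$, and let $G_{\mathcal{P},n}$ be the image of $\mathrm{Gal}(\bar k/k)$ in $\mathrm{Aut}(\mathcal{A}[\mathcal{P}^n])$. Suppose that the determinant of the representation $\rho_{\mathcal{P}}\colon\mathrm{Gal}(\bar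 k/k)\to \mathrm{GL}_2(\mathcal{O}_{E,\mathcal{P}})$ on $\mathcal{A}[\mathcal{P}^\infty]$ is the $p$-adic cyclotomic character. Suppose that for some $n$ the group $H^1_{\mathrm{loc}}(G_{\mathcal{P},n},\mathcal{A}[\mathcal{P}^n])$, consisting of the classes in $H^1(G_{\mathcal{P},n},\mathcal{A}[\mathcal{P}^n])$ of the cocycles $Z$ such that for every $\gamma$ there is $m_\gamma$ with $Z_\gamma=\gamma m_\gamma-m_\gamma$, is not $0$. Let $g\in G_{\mathcal{P},1}$ be an element of order dividing $q-1$ whose determinant in $\mathbb{F}_q^*$ has order $p-1$, such that $G_{\mathcal{P},1}$ has a unique $p$-Sylow subgroup and is generated by it together with $g$. Let $\lambda_1,\lambda_2\in\mathbb{F}_q^*$ be the eigenvalues of $g$ acting on $\mathcal{A}[\mathcal{P}]\simeq\mathbb{F}_q^2$ (with multiplicity). Suppose that $\lambda_1\ne 1$, $\lambda_2\neq 1$ and $p\ge 3d+1$. Then at least one of the following holds, where conjugacy is over $\mathbb{F}_p$: 1. $\lambda_1$ is Galois-conjugate to $\lambda_1\lambda_2^{-1}$; 2. $\lambda_1$ is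 Galois-conjugate to $\lambda_2\lambda_1^{-1}$; 3. $\lambda_2$ is Galois-conjugate to $\lambda_1\lambda_2^{-1}$; 4. $\lambda_2$ is Galois-conjugate to $\lambda_2\lambda_1^{-1}$. Moreover, $\lambda_1$ or $\lambda_2$ has order at most $C=2^{(d+1)^{2\ln d/\ln 2}+1}$. -/

import Mathlib

open scoped NumberField TensorProduct

universe u v

noncomputable section

open CategoryTheory AlgebraicGeometry

/-! ### Abelian varieties, their endomorphism rings and their geometric points -/

/-- An abelian variety over a field `k`: a proper geometrically integral group scheme over `k`. -/
structure AbelianVariety (k : Type u) [Field k] where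
  /-- The underlying scheme over `k`. -/
  X : Over (Spec (.of k))
  [grp : GrpObj X]
  [proper : IsProper X.hom]
  [geomIntegral : GeometricallyIntegral X.hom]

namespace AbelianVariety

attribute [instance] AbelianVariety.grp AbelianVariety.proper AbelianVariety.geomIntegral

section

open scoped CategoryTheory.MonObj

variable {k : Type u} [Field k] (A : AbelianVariety k)

instance isCommMonObj : IsCommMonObj A.X :=
  isCommMonObj_of_isProper_of_geometricallyIntegral A.X

/-- The set `End_k(A)` of endomorphisms of the group scheme `A` over `k`. -/
@[ext]
structure EndRing where
  /-- The underlying morphism of schemes over `k`. -/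
  hom : A.X ⟶ A.X
  [isMonHom : IsMonHom hom]

attribute [instance] EndRing.isMonHom

namespace EndRing

variable {A}

instance : IsMonHom (1 : A.X ⟶ A.X) := by rw [Hom.one_def]; infer_instance

instance (f g : A.X ⟶ A.X) [IsMonHom f] [IsMonHom g] : IsMonHom (f * g) := by
  rw [Hom.mul_def]; infer_instance

instance : Zero (EndRing A) := ⟨⟨1⟩⟩
instance : One (EndRing A) := ⟨⟨𝟙 A.X⟩⟩
instance : Add (EndRing A) := ⟨fun f g => ⟨f.hom * g.hom⟩⟩
instance : Neg (EndRing A) := ⟨fun f => ⟨f.hom⁻¹⟩⟩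
instance : Mul (EndRing A) := ⟨fun f g => ⟨g.hom ≫ f.hom⟩⟩

@[simp] theorem zero_hom : (0 : EndRing A).hom = 1 := rfl
@[simp] theorem one_hom : (1 : EndRing A).hom = 𝟙 A.X := rfl
@[simp] theorem add_hom (f g : EndRing A) : (f + g).hom = f.hom * g.hom := rfl
@[simp] theorem neg_hom (f : EndRing A) : (-f).hom = f.hom⁻¹ := rfl
@[simp] theorem mul_hom (f g : EndRing A) : (f * g).hom = g.hom ≫ f.hom := rfl

/-- `End_k(A)`, with pointwise addition, and with composition as multiplication. -/
instance : Ring (EndRing A) where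
  add_assoc f g h := by ext1; simp only [add_hom, mul_assoc]
  zero_add f := by ext1; simp
  add_zero f := by ext1; simp
  add_comm f g := by ext1; simp [mul_comm]
  neg_add_cancel f := by ext1; simp
  mul_assoc f g h := by ext1; simp
  one_mul f := by ext1; simp
  mul_one f := by ext1; simp
  zero_mul f := by ext1; simp
  mul_zero f := by ext1; simp
  left_distrib f g h := by ext1; simp [MonObj.mul_comp]
  right_distrib f g h := by ext1; simp [MonObj.comp_mul]
  nsmul := nsmulRec
  zsmul := zsmulRec

end EndRing

variable (k) in
/-- `Spec k̄` as a scheme over `k`. -/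
abbrev geomPt : Over (Spec (.of k)) :=
  Over.mk (Spec.map (CommRingCat.ofHom (algebraMap k (AlgebraicClosure k))))

/-- The morphism `Spec k̄ ⟶ Spec k̄` over `k` given by an element of the Galois group. -/
def specGal (σ : Gal(AlgebraicClosure k/k)) : geomPt k ⟶ geomPt k :=
  Over.homMk (Spec.map (CommRingCat.ofHom (σ : AlgebraicClosure k →+* AlgebraicClosure k))) (by
    simp only [Over.mk_left, Over.mk_hom, ← Spec.map_comp, ← CommRingCat.ofHom_comp]
    congr 2
    ext x
    simp)

theorem specGal_one : specGal (1 : Gal(AlgebraicClosure k/k)) = 𝟙 _ := by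
  ext1
  exact Spec.map_id _

theorem specGal_mul (σ τ : Gal(AlgebraicClosure k/k)) :
    specGal (σ * τ) = specGal σ ≫ specGal τ := by
  ext1
  exact Spec.map_comp (CommRingCat.ofHom (τ : AlgebraicClosure k →+* AlgebraicClosure k))
    (CommRingCat.ofHom (σ : AlgebraicClosure k →+* AlgebraicClosure k))

/-- The group `A(k̄)`, written additively. -/
def Points : Type u := Additive (geomPt k ⟶ A.X)

instance : AddCommGroup A.Points := inferInstanceAs (AddCommGroup (Additive (geomPt k ⟶ A.X)))

variable {A}

/-- The action of `End_k(A)` on `A(k̄)`. -/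
def EndRing.onPoints (f : EndRing A) : A.Points →+ A.Points :=
  MonoidHom.toAdditive
    { toFun := fun x : geomPt k ⟶ A.X => x ≫ f.hom
      map_one' := by simp
      map_mul' := fun x y => MonObj.mul_comp x y f.hom }

/-- The action of the absolute Galois group of `k` on `A(k̄)`. -/
instance : DistribMulAction Gal(AlgebraicClosure k/k) A.Points where
  smul σ x := Additive.ofMul (specGal σ ≫ (Additive.toMul x : geomPt k ⟶ A.X))
  one_smul x := by
    change specGal 1 ≫ (Additive.toMul x : geomPt k ⟶ A.X) = x
    rw [specGal_one, Category.id_comp]; rfl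
  mul_smul σ τ x := by
    change specGal (σ * τ) ≫ (Additive.toMul x : geomPt k ⟶ A.X) =
      specGal σ ≫ specGal τ ≫ (Additive.toMul x : geomPt k ⟶ A.X)
    rw [specGal_mul, Category.assoc]
  smul_zero σ := MonObj.comp_one (specGal σ)
  smul_add σ x y := MonObj.comp_mul (specGal σ) (Additive.toMul x : geomPt k ⟶ A.X)
    (Additive.toMul y : geomPt k ⟶ A.X)

theorem onPoints_smul (f : EndRing A) (σ : Gal(AlgebraicClosure k/k)) (x : A.Points) :
    f.onPoints (σ • x) = σ • f.onPoints x :=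
  Category.assoc (specGal σ) (Additive.toMul x : geomPt k ⟶ A.X) f.hom

/-! ### The action of a number field `E`, the order `R`, and the modules `A[I]` -/

variable {E : Type v} [Field E] [NumberField E]

/-- The order `R = φ⁻¹(End_k(A))` of `𝓞 E`, for an embedding `φ : E → End_k(A) ⊗ ℚ`. -/
def endOrder (φ : E →+* EndRing A ⊗[ℤ] ℚ) : Subring (𝓞 E) :=
  (Algebra.TensorProduct.includeLeftRingHom : EndRing A →+* EndRing A ⊗[ℤ] ℚ).range.comap
    (φ.comp (algebraMap (𝓞 E) E))

/-- The prime `p` is good: it does not divide the index `[𝓞 E : R]` (which has to be finite,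
an infinite index being `0` here). -/
def IsGoodPrime (φ : E →+* EndRing A ⊗[ℤ] ℚ) (p : ℕ) : Prop :=
  ¬ p ∣ (endOrder φ).toAddSubgroup.index

/-- The endomorphism `f` of `A` is the action of the element `r` of `𝓞 E`. -/
def Represents (φ : E →+* EndRing A ⊗[ℤ] ℚ) (f : EndRing A) (r : 𝓞 E) : Prop :=
  φ (algebraMap (𝓞 E) E r) = f ⊗ₜ[ℤ] (1 : ℚ)

/-- For an ideal `I` of `𝓞 E`, the group `A[I]` of all geometric points killed by `I ∩ R`. -/
def torsion (φ : E →+* EndRing A ⊗[ℤ] ℚ) (I : Ideal (𝓞 E)) : AddSubgroup A.Points where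
  carrier := {x | ∀ α ∈ I, ∀ f : EndRing A, Represents φ f α → f.onPoints x = 0}
  zero_mem' := fun _ _ f _ => map_zero f.onPoints
  add_mem' := fun hx hy α hα f hf => by rw [map_add, hx α hα f hf, hy α hα f hf, add_zero]
  neg_mem' := fun hx α hα f hf => by rw [map_neg, hx α hα f hf, neg_zero]

/-- The Galois action on `A[I]`. -/
instance (φ : E →+* EndRing A ⊗[ℤ] ℚ) (I : Ideal (𝓞 E)) :
    DistribMulAction Gal(AlgebraicClosure k/k) (torsion φ I) where
  smul σ x := ⟨σ • (x : A.Points), fun α hα f hf => by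
    rw [onPoints_smul, x.2 α hα f hf, smul_zero]⟩
  one_smul x := Subtype.ext (one_smul _ (x : A.Points))
  mul_smul σ τ x := Subtype.ext (mul_smul σ τ (x : A.Points))
  smul_zero σ := Subtype.ext (smul_zero (A := A.Points) σ)
  smul_add σ x y := Subtype.ext (smul_add σ (x : A.Points) (y : A.Points))

/-- The group `G_I`: the image of the absolute Galois group of `k` in `Aut(A[I])`. For `I = P ^ n`
this is the image of `Gal(k(A[p ^ n])/k)`. -/
def galImage (φ : E →+* EndRing A ⊗[ℤ] ℚ) (I : Ideal (𝓞 E)) : Subgroup (torsion φ I ≃ₗ[ℤ] torsion φ I) :=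
  (DistribMulAction.toModuleAut ℤ (torsion φ I) (S := Gal(AlgebraicClosure k/k))).range

/-! ### Matrices, determinants, eigenvalues -/

/-- A basis of `A[I]` over `𝓞 E ⧸ I`, given by the coordinates `A[I] ≃ (𝓞 E ⧸ I)²`: an isomorphism
of groups that is compatible with the actions of `R`. (When the index of `R` is prime to `I`,
`R` surjects onto `𝓞 E ⧸ I`, so this is the same as linearity over `𝓞 E ⧸ I`.) -/
structure TorsionBasis (φ : E →+* EndRing A ⊗[ℤ] ℚ) (I : Ideal (𝓞 E)) where
  /-- The coordinates. -/
  coord : torsion φ I ≃+ (Fin 2 → 𝓞 E ⧸ I)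
  map_act : ∀ (r : 𝓞 E) (f : EndRing A), Represents φ f r → ∀ x y : torsion φ I,
    (y : A.Points) = f.onPoints x → coord y = Ideal.Quotient.mk I r • coord x

/-- The matrix of an automorphism of `A[I]` in a basis. -/
def TorsionBasis.matrix {φ : E →+* EndRing A ⊗[ℤ] ℚ} {I : Ideal (𝓞 E)} (b : TorsionBasis φ I)
    (s : torsion φ I ≃ₗ[ℤ] torsion φ I) : Matrix (Fin 2) (Fin 2) (𝓞 E ⧸ I) :=
  Matrix.of fun i j => b.coord (s (b.coord.symm (Pi.single j 1))) i

/-- The automorphism `s` of `A[I] ≃ (𝓞 E ⧸ I)²` has determinant `δ`. -/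
def HasDet {φ : E →+* EndRing A ⊗[ℤ] ℚ} {I : Ideal (𝓞 E)} (s : torsion φ I ≃ₗ[ℤ] torsion φ I)
    (δ : 𝓞 E ⧸ I) : Prop :=
  ∃ b : TorsionBasis φ I, (b.matrix s).det = δ

/-- The automorphism `s` of `A[I] ≃ (𝓞 E ⧸ I)²` has the eigenvalues `l₁`, `l₂`, counted with
multiplicity. -/
def HasEigenvalues {φ : E →+* EndRing A ⊗[ℤ] ℚ} {I : Ideal (𝓞 E)} (s : torsion φ I ≃ₗ[ℤ] torsion φ I)
    (l₁ l₂ : 𝓞 E ⧸ I) : Prop :=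
  ∃ b : TorsionBasis φ I,
    (b.matrix s).charpoly = (Polynomial.X - Polynomial.C l₁) * (Polynomial.X - Polynomial.C l₂)

/-- The determinant of the representation `ρ_P : Gal(k̄/k) → GL₂(𝓞_{E,P})` on `A[P ^ ∞]` is the
`p`-adic cyclotomic character: on each `A[P ^ n] ≃ (𝓞 E ⧸ P ^ n)²`, every `σ` has determinant
`χ_p(σ) mod p ^ n`. -/
def DetIsCyclotomic (φ : E →+* EndRing A ⊗[ℤ] ℚ) (p : ℕ) [Fact p.Prime] (P : Ideal (𝓞 E)) :
    Prop :=
  ∀ (n : ℕ) (σ : Gal(AlgebraicClosure k/k)),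
    HasDet (DistribMulAction.toModuleAut ℤ (torsion φ (P ^ n)) σ)
      ((PadicInt.toZModPow n
        (cyclotomicCharacter (AlgebraicClosure k) p σ.toRingEquiv : ℤ_[p])).val : 𝓞 E ⧸ P ^ n)

/-- `g` is an element of `G_P` such that `G_P` is generated by `g` and its unique `p`-Sylow
subgroup, `g` has order dividing `q - 1` where `q = #(𝓞 E ⧸ P)`, and the determinant of `g` has
order `p - 1`. -/
structure IsBorelGenerator (φ : E →+* EndRing A ⊗[ℤ] ℚ) (p : ℕ) (P : Ideal (𝓞 E))
    (g : galImage φ P) : Prop where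
  unique_sylow : ∀ N N' : Sylow p (galImage φ P), N = N'
  generates : ∀ N : Sylow p (galImage φ P), (N : Subgroup (galImage φ P)) ⊔ .zpowers g = ⊤
  orderOf_dvd : orderOf g ∣ Nat.card (𝓞 E ⧸ P) - 1
  orderOf_det : ∃ δ : (𝓞 E ⧸ P)ˣ, HasDet (g : torsion φ P ≃ₗ[ℤ] torsion φ P) (δ : 𝓞 E ⧸ P) ∧
    orderOf δ = p - 1

end

end AbelianVariety

/-! ### The first local cohomology group -/

section

variable (G : Type*) [Group G] (M : Type*) [AddCommGroup M] [DistribMulAction G M]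

/-- The `1`-cocycles `Z : G → M` that satisfy the local conditions: for each `s` there is `m` with
`Z s = s m - m`. -/
def locCocycles : AddSubgroup (G → M) where
  carrier := {Z | (∀ s t, Z (s * t) = Z s + s • Z t) ∧ ∀ s, ∃ m : M, Z s = s • m - m}
  zero_mem' := ⟨by simp, fun s => ⟨0, by simp⟩⟩
  add_mem' := by
    rintro Y Z ⟨hY, hY'⟩ ⟨hZ, hZ'⟩
    refine ⟨fun s t => ?_, fun s => ?_⟩
    · simp only [Pi.add_apply, hY, hZ, smul_add]; abel
    · obtain ⟨m, hm⟩ := hY' s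
      obtain ⟨m', hm'⟩ := hZ' s
      exact ⟨m + m', by simp only [Pi.add_apply, hm, hm', smul_add]; abel⟩
  neg_mem' := by
    rintro Z ⟨hZ, hZ'⟩
    refine ⟨fun s t => ?_, fun s => ?_⟩
    · simp only [Pi.neg_apply, hZ, smul_neg]; abel
    · obtain ⟨m, hm⟩ := hZ' s
      exact ⟨-m, by simp only [Pi.neg_apply, hm, smul_neg]; abel⟩

/-- The `1`-coboundaries `s ↦ s m - m`. -/
def oneCoboundaries : AddSubgroup (G → M) where
  carrier := {Z | ∃ m : M, ∀ s, Z s = s • m - m}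
  zero_mem' := ⟨0, by simp⟩
  add_mem' := by
    rintro Y Z ⟨m, hm⟩ ⟨m', hm'⟩
    exact ⟨m + m', fun s => by simp only [Pi.add_apply, hm, hm', smul_add]; abel⟩
  neg_mem' := by
    rintro Z ⟨m, hm⟩
    exact ⟨-m, fun s => by simp only [Pi.neg_apply, hm, smul_neg]; abel⟩

/-- The first local cohomology group `H¹_loc(G, M)`, the group of classes in `H¹(G, M)` of
cocycles that satisfy the local conditions. -/
abbrev H1loc : Type _ :=
  locCocycles G M ⧸ (oneCoboundaries G M).addSubgroupOf (locCocycles G M)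

end

/-- Two elements of a finite field `F` are Galois conjugate over the prime field. -/
def IsGaloisConj {F : Type*} [CommRing F] (a b : F) : Prop := ∃ τ : F ≃+* F, τ a = b

end

/-!
Write `F = 𝓞 E ⧸ P`, `q = #F`, `Λ = 𝓞 E ⧸ P ^ n`, and let `𝔪` be the kernel of `Λ → F`.
The theorem follows from a vanishing statement (`AbelianVariety.subsingleton_H1loc_torsion_pow`):
*the group `H¹_loc` of `A[P ^ n]` is zero unless `l₁` is conjugate to `l₁ / l₂`, or `l₂` is
conjugate to `l₂ / l₁`.* So one of these two of the four relations always holds. In the first case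
let `τ` be an automorphism of `F` with `τ l₁ = l₁ / l₂`. The determinant `l₁ l₂` has order `p - 1`,
so it lies in the prime field and is fixed by `τ`; hence `τ l₂ = l₂ ^ 2`, and as `τ ^ f = 1` for
`q = p ^ f`, the order of `l₂` divides `2 ^ f - 1` (`orderOf_le_of_isGaloisConj`). The second case is
symmetric. As `f ≤ [E : ℚ]`, this is far below the bound of the statement.

For the vanishing, choose a basis of `A[P ^ n]` in which some `γ` in the Galois group that lifts `g`
is diagonal, with Teichmüller eigenvalues, and in which the preimage `N` of the Sylow subgroup is
lower unipotent modulo `𝔪` (`exists_eigenbasis`, `exists_diagonal_lift`). Let `Z` be a locally trivial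
cocycle; after subtracting a coboundary, `Z γ = 0`, so that `Z` commutes with conjugation by `γ`.
It has to be shown that `Z` vanishes on `N`, and this is done by induction on the powers of `𝔪`,
one coordinate at a time. For the first coordinate (the eigenvalue `a` of `γ`, the other one being
`b`), take a polynomial `c = ∑ T ^ i` over a list of exponents `i`, with `c a = 1` and
`c 1 = c (a / b) = 0` in `F`; it exists as `a` is conjugate neither to `1` nor to `a / b`. Replacing
`h ∈ N` by the product of the conjugates `γ ^ i h γ ^ (-i)` does not change the first coordinate of
`Z h` to leading order, as `c a = 1`. On the matrix of `h` it improves the congruences satisfied by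
the diagonal, where `γ` acts with eigenvalue `1`, and by the upper right entry, where `γ` acts with
eigenvalue `a / b`. Iterating, one arrives at a lower unipotent matrix `h'`
(`conjProd_iterate_mem`). Now `Z h'` is in the image of `h' - 1` by local triviality, so its first
coordinate is zero (`locCocycle_coord_mem`). The second coordinate is treated in the same way, with
upper unipotent matrices.

The geometry enters only through the coordinates on `A[P ^ n]`, which the hypothesis on
determinants provides. They are `Λ`-linear because the order `R`, of index prime to `p`, surjects
onto `Λ`; and multiplication by an element of `P ^ (n - 1)` outside `P ^ n` identifies the
reduction of `A[P ^ n]` with `A[P]` (`AbelianVariety.exists_reduction_basis`).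
-/

/-! ### Power sums that separate Galois orbits -/

/-- Every polynomial over `ZMod p` is represented by a list of exponents, with multiplicity. -/
theorem exists_list_sum_pow_eq_aeval (p : ℕ) [Fact p.Prime] {F : Type*} [Field F]
    [Algebra (ZMod p) F] (f : Polynomial (ZMod p)) :
    ∃ L : List ℕ, ∀ x : F, (L.map (x ^ ·)).sum = Polynomial.aeval x f := by
  induction f using Polynomial.induction_on' with
  | add f g hf hg =>
    obtain ⟨L, hL⟩ := hf
    obtain ⟨L', hL'⟩ := hg
    exact ⟨L ++ L', fun x => by simp [hL, hL']⟩
  | monomial m c =>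
    refine ⟨List.replicate c.val m, fun x => ?_⟩
    rw [List.map_replicate, List.sum_replicate, Polynomial.aeval_monomial, nsmul_eq_mul]
    congr 1
    rw [← map_natCast (algebraMap (ZMod p) F), ZMod.natCast_zmod_val]

/-- If `a` is conjugate neither to `1` nor to `v` over the prime field, some integral polynomial
takes the value `1` at `a` and vanishes at `1` and at `v`. -/
theorem exists_list_sum_pow_separating (p : ℕ) [Fact p.Prime] {F : Type*} [Field F] [Finite F]
    [CharP F p] {a v : F} (ha : a ≠ 1) (hv : ¬ IsGaloisConj a v) :
    ∃ L : List ℕ, (L.map (a ^ ·)).sum = 1 ∧ (L.length : F) = 0 ∧ (L.map (v ^ ·)).sum = 0 := by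
  let _ := ZMod.algebra F p
  have hint : ∀ x : F, IsIntegral (ZMod p) x := fun x => Algebra.IsIntegral.isIntegral x
  have key : ∀ w : F, ¬ IsGaloisConj a w → IsCoprime (minpoly (ZMod p) a) (minpoly (ZMod p) w) := by
    intro w hw
    refine ((minpoly.irreducible (hint a)).coprime_iff_not_dvd).2 fun hdvd => hw ?_
    have heq : minpoly (ZMod p) a = minpoly (ZMod p) w :=
      Polynomial.eq_of_monic_of_associated (minpoly.monic (hint a)) (minpoly.monic (hint w))
        ((minpoly.irreducible (hint a)).associated_of_dvd (minpoly.irreducible (hint w)) hdvd)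
    obtain ⟨τ, hτ⟩ := (isConjRoot_iff_exists_algEquiv (K := ZMod p)).1
      (show IsConjRoot (ZMod p) a w from heq)
    exact ⟨(τ.symm : F ≃+* F), by rw [← hτ]; exact τ.symm_apply_apply w⟩
  have h1 : ¬ IsGaloisConj a 1 := fun ⟨τ, hτ⟩ => ha (by simpa using hτ)
  obtain ⟨A, B, hAB⟩ := IsCoprime.mul_right (key 1 h1) (key v hv)
  obtain ⟨L, hL⟩ := exists_list_sum_pow_eq_aeval p (F := F)
    (B * (minpoly (ZMod p) (1 : F) * minpoly (ZMod p) v))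
  refine ⟨L, ?_, ?_, ?_⟩
  · have := congrArg (Polynomial.aeval a) hAB
    rw [map_add, map_mul, minpoly.aeval, mul_zero, zero_add, map_one] at this
    exact (hL a).trans this
  · have := hL 1
    rw [map_mul, map_mul, minpoly.aeval, zero_mul, mul_zero] at this
    simpa using this
  · refine (hL v).trans ?_
    rw [map_mul, map_mul, minpoly.aeval, mul_zero, mul_zero]

/-! ### Products of conjugates and congruence conditions on matrices -/

/-- The product of the conjugates `γ ^ i * h * γ ^ (-i)`, for `i` in the list `L`. On an
abelian group that `γ` acts on by conjugation, it is the polynomial `∑ i ∈ L, T ^ i` in that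
action `T`. -/
def conjProd {Γ : Type*} [Group Γ] (γ : Γ) (L : List ℕ) (h : Γ) : Γ :=
  (L.map fun i => γ ^ i * h * (γ ^ i)⁻¹).prod

/-- A function that is additive modulo `J` on a submonoid turns products into sums modulo `J`. -/
theorem list_prod_sub_sum_mem {Γ Λ : Type*} [Monoid Γ] [CommRing Λ] (S : Submonoid Γ)
    (J : Ideal Λ) (f : Γ → Λ) (h1 : f 1 ∈ J)
    (hmul : ∀ s ∈ S, ∀ t ∈ S, f (s * t) - (f s + f t) ∈ J) (l : List Γ) (hl : ∀ s ∈ l, s ∈ S) :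
    f l.prod - (l.map f).sum ∈ J := by
  induction l with
  | nil => simpa using h1
  | cons s l ih =>
    rw [List.prod_cons, List.map_cons, List.sum_cons]
    have h := hmul s (hl s (by simp)) l.prod
      (S.list_prod_mem fun t ht => hl t (by simp [ht]))
    have h' := ih fun t ht => hl t (by simp [ht])
    convert J.add_mem h h' using 1
    ring

section Congruence

variable {Λ : Type*} [CommRing Λ]

theorem Matrix.mul_apply_fin_two {i j : Fin 2} (hij : i ≠ j) (B C : Matrix (Fin 2) (Fin 2) Λ)
    (r c : Fin 2) : (B * C) r c = B r i * C i c + B r j * C j c := by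
  rw [Matrix.mul_apply, Fin.sum_univ_two]
  fin_cases i <;> fin_cases j <;> first | exact absurd rfl hij | rfl | exact add_comm _ _

/-- The `2 × 2` matrices with diagonal entries in `1 + D`, with `(i, j)` entry in `X` and with
`(j, i)` entry in `Y`. -/
def congruenceSubmonoid (i j : Fin 2) (hij : i ≠ j) (D X Y : Ideal Λ) (hXY : X * Y ≤ D) :
    Submonoid (Matrix (Fin 2) (Fin 2) Λ) where
  carrier := {B | B i i - 1 ∈ D ∧ B j j - 1 ∈ D ∧ B i j ∈ X ∧ B j i ∈ Y}
  one_mem' := by simp [hij, hij.symm]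
  mul_mem' := by
    rintro B C ⟨h1, h2, h3, h4⟩ ⟨h1', h2', h3', h4'⟩
    have hsum := Matrix.mul_apply_fin_two hij B C
    refine ⟨?_, ?_, ?_, ?_⟩
    · have e : (B * C) i i - 1 = (B i i - 1) * C i i + (C i i - 1) + B i j * C j i := by
        rw [hsum]; ring
      rw [e]
      exact D.add_mem (D.add_mem (D.mul_mem_right _ h1) h1') (hXY (Ideal.mul_mem_mul h3 h4'))
    · have e : (B * C) j j - 1 = (B j j - 1) * C j j + (C j j - 1) + C i j * B j i := by
        rw [hsum]; ring
      rw [e]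
      exact D.add_mem (D.add_mem (D.mul_mem_right _ h2) h2') (hXY (Ideal.mul_mem_mul h3' h4))
    · rw [hsum]
      exact X.add_mem (X.mul_mem_left _ h3') (X.mul_mem_right _ h3)
    · rw [hsum]
      exact Y.add_mem (Y.mul_mem_right _ h4) (Y.mul_mem_left _ h4')

theorem Matrix.mulVec_apply_fin_two {i j : Fin 2} (hij : i ≠ j) (B : Matrix (Fin 2) (Fin 2) Λ)
    (w : Fin 2 → Λ) (r : Fin 2) : (B.mulVec w) r = B r i * w i + B r j * w j := by
  rw [Matrix.mulVec, dotProduct, Fin.sum_univ_two]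
  fin_cases i <;> fin_cases j <;> first | exact absurd rfl hij | rfl | exact add_comm _ _

variable {Γ : Type*} [Group Γ] (ρ : Γ →* Matrix (Fin 2) (Fin 2) Λ) {γ : Γ} {d : Fin 2 → Λˣ}

theorem conj_entry (hγ : ρ γ = Matrix.diagonal fun r => (d r : Λ)) (l : ℕ) (h : Γ)
    (r c : Fin 2) :
    ρ (γ ^ l * h * (γ ^ l)⁻¹) r c = (((d r * (d c)⁻¹) ^ l : Λˣ) : Λ) * ρ h r c := by
  have h1 : ρ (γ ^ l * h * (γ ^ l)⁻¹) * ρ (γ ^ l) = ρ (γ ^ l) * ρ h := by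
    rw [← map_mul, ← map_mul, inv_mul_cancel_right]
  have h2 : ρ (γ ^ l) = Matrix.diagonal fun r => ((d r ^ l : Λˣ) : Λ) := by
    rw [map_pow, hγ, Matrix.diagonal_pow]
    congr 1
  have h3 := congrFun (congrFun h1 r) c
  rw [h2, Matrix.mul_diagonal, Matrix.diagonal_mul] at h3
  have h4 : ((d c ^ l : Λˣ) : Λ) * (((d c ^ l)⁻¹ : Λˣ) : Λ) = 1 := Units.mul_inv _
  rw [mul_pow, inv_pow, Units.val_mul]
  linear_combination (((d c ^ l)⁻¹ : Λˣ) : Λ) * h3 - ρ (γ ^ l * h * (γ ^ l)⁻¹) r c * h4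

variable {i j : Fin 2} {hij : i ≠ j} {D X Y J : Ideal Λ} {hXY : X * Y ≤ D}

theorem conj_mem_congruenceSubmonoid (hγ : ρ γ = Matrix.diagonal fun r => (d r : Λ)) (l : ℕ)
    {h : Γ} (hh : ρ h ∈ congruenceSubmonoid i j hij D X Y hXY) :
    ρ (γ ^ l * h * (γ ^ l)⁻¹) ∈ congruenceSubmonoid i j hij D X Y hXY := by
  obtain ⟨h1, h2, h3, h4⟩ := hh
  refine ⟨?_, ?_, ?_, ?_⟩
  · simpa [conj_entry ρ hγ] using h1
  · simpa [conj_entry ρ hγ] using h2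
  · rw [conj_entry ρ hγ]; exact X.mul_mem_left _ h3
  · rw [conj_entry ρ hγ]; exact Y.mul_mem_left _ h4

theorem conjProd_mem_congruenceSubmonoid (hγ : ρ γ = Matrix.diagonal fun r => (d r : Λ))
    (L : List ℕ) {h : Γ} (hh : ρ h ∈ congruenceSubmonoid i j hij D X Y hXY) :
    ρ (conjProd γ L h) ∈ congruenceSubmonoid i j hij D X Y hXY := by
  rw [conjProd, map_list_prod]
  refine Submonoid.list_prod_mem _ fun B hB => ?_
  simp only [List.map_map, List.mem_map, Function.comp_apply] at hB
  obtain ⟨l, -, rfl⟩ := hB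
  exact conj_mem_congruenceSubmonoid ρ hγ l hh

/-- A function on the group that is additive modulo `J` on a submonoid `S`, and that
conjugation by `γ` multiplies by `e`, is multiplied by `∑ l ∈ L, e ^ l` by `conjProd γ L`. -/
theorem conjProd_sub_mul_mem (L : List ℕ)
    (S : Submonoid Γ) (hS : ∀ l : ℕ, ∀ h ∈ S, γ ^ l * h * (γ ^ l)⁻¹ ∈ S)
    (f : Γ → Λ) (e : Λ) (h1 : f 1 ∈ J)
    (hmul : ∀ s ∈ S, ∀ t ∈ S, f (s * t) - (f s + f t) ∈ J)
    (hconj : ∀ l : ℕ, ∀ h ∈ S, f (γ ^ l * h * (γ ^ l)⁻¹) = e ^ l * f h) {h : Γ} (hh : h ∈ S) :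
    f (conjProd γ L h) - (L.map (e ^ ·)).sum * f h ∈ J := by
  have := list_prod_sub_sum_mem S J f h1 hmul (L.map fun l => γ ^ l * h * (γ ^ l)⁻¹) (by
    simp only [List.mem_map]
    rintro _ ⟨l, -, rfl⟩
    exact hS l h hh)
  have hmap : (L.map fun l => γ ^ l * h * (γ ^ l)⁻¹).map f = L.map fun l => e ^ l * f h := by
    rw [List.map_map]
    exact List.map_congr_left fun l _ => hconj l h hh
  rwa [hmap, List.sum_map_mul_right] at this

/-- If the polynomial given by `L` vanishes modulo `𝔪` at the ratio through which `γ` acts on the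
`(i, j)` entry, then `conjProd γ L` improves the congruence satisfied by this entry. -/
theorem conjProd_offDiag (hγ : ρ γ = Matrix.diagonal fun r => (d r : Λ)) (L : List ℕ)
    (hJ : D * X ≤ J) {𝔪 : Ideal Λ} (hmJ : 𝔪 * X ≤ J)
    (hL : (L.map ((((d i * (d j)⁻¹ : Λˣ) : Λ)) ^ ·)).sum ∈ 𝔪)
    {h : Γ} (hh : ρ h ∈ congruenceSubmonoid i j hij D X Y hXY) :
    ρ (conjProd γ L h) i j ∈ J := by
  have key := conjProd_sub_mul_mem (J := J) (γ := γ) L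
    ((congruenceSubmonoid i j hij D X Y hXY).comap ρ)
    (fun l h hh => conj_mem_congruenceSubmonoid (hij := hij) (hXY := hXY) ρ hγ l hh)
    (fun s => ρ s i j)
    ((d i * (d j)⁻¹ : Λˣ) : Λ) (by simp [hij]) (fun s hs t ht => by
      obtain ⟨h1, h2, h3, h4⟩ := hs
      obtain ⟨h1', h2', h3', h4'⟩ := ht
      have e : ρ (s * t) i j - (ρ s i j + ρ t i j) =
          (ρ s i i - 1) * ρ t i j + (ρ t j j - 1) * ρ s i j := by
        rw [map_mul, Matrix.mul_apply_fin_two hij]; ring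
      rw [e]
      exact J.add_mem (hJ (Ideal.mul_mem_mul h1 h3')) (hJ (Ideal.mul_mem_mul h2' h3)))
    (fun l s _ => by simp only [conj_entry ρ hγ, Units.val_pow_eq_pow_val]) hh
  have h2 := hmJ (Ideal.mul_mem_mul hL hh.2.2.1)
  simpa using J.add_mem key h2

/-- If the length of `L` vanishes modulo `𝔪`, then `conjProd γ L` improves the congruences
satisfied by the diagonal entries. -/
theorem conjProd_diag (hγ : ρ γ = Matrix.diagonal fun r => (d r : Λ)) (L : List ℕ)
    (hJ : D * D ≤ J) (hXJ : X * Y ≤ J) {𝔪 : Ideal Λ} (hmJ : 𝔪 * D ≤ J)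
    (hL : (L.length : Λ) ∈ 𝔪)
    {h : Γ} (hh : ρ h ∈ congruenceSubmonoid i j hij D X Y hXY) :
    ρ (conjProd γ L h) i i - 1 ∈ J ∧ ρ (conjProd γ L h) j j - 1 ∈ J := by
  have key : ∀ r, (r = i ∨ r = j) → ρ (conjProd γ L h) r r - 1 ∈ J := by
    intro r hr
    have hD : ∀ s, ρ s ∈ congruenceSubmonoid i j hij D X Y hXY → ρ s r r - 1 ∈ D := by
      intro s hs
      rcases hr with rfl | rfl
      exacts [hs.1, hs.2.1]
    have := conjProd_sub_mul_mem (J := J) (γ := γ) L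
      ((congruenceSubmonoid i j hij D X Y hXY).comap ρ)
      (fun l h hh => conj_mem_congruenceSubmonoid (hij := hij) (hXY := hXY) ρ hγ l hh)
      (fun s => ρ s r r - 1) 1
      (by simp) (fun s hs t ht => by
        have hst := J.add_mem (hJ (Ideal.mul_mem_mul (hD s hs) (hD t ht)))
          (show (if r = i then ρ s i j * ρ t j i else ρ t i j * ρ s j i) ∈ J by
            split_ifs
            · exact hXJ (Ideal.mul_mem_mul hs.2.2.1 ht.2.2.2)
            · exact hXJ (Ideal.mul_mem_mul ht.2.2.1 hs.2.2.2))
        convert hst using 1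
        rw [map_mul, Matrix.mul_apply_fin_two hij]
        rcases hr with rfl | rfl
        · rw [if_pos rfl]; ring
        · rw [if_neg hij.symm]; ring)
      (fun l s _ => by simp [conj_entry ρ hγ]) hh
    have h2 := hmJ (Ideal.mul_mem_mul hL (hD h hh))
    simpa using J.add_mem this h2
  exact ⟨key i (.inl rfl), key j (.inr rfl)⟩

/-- Iterating `conjProd γ L` makes a matrix converge `𝔪`-adically to a unipotent matrix whose only
nontrivial entry is the `(j, i)` entry. -/
theorem conjProd_iterate_mem {𝔪 : Ideal Λ} {s t : ℕ} (hst : s + t = 1)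
    (hγ : ρ γ = Matrix.diagonal fun r => (d r : Λ)) (hij : i ≠ j) (L : List ℕ)
    (hL : (L.length : Λ) ∈ 𝔪)
    (hL' : (L.map ((((d i * (d j)⁻¹ : Λˣ) : Λ)) ^ ·)).sum ∈ 𝔪) {h : Γ}
    (hh : ρ h i i - 1 ∈ 𝔪 ∧ ρ h j j - 1 ∈ 𝔪 ∧ ρ h i j ∈ 𝔪 ^ s ∧ ρ h j i ∈ 𝔪 ^ t) (k : ℕ) :
    ρ ((conjProd γ L)^[2 * k] h) ∈ congruenceSubmonoid i j hij (𝔪 ^ (k + 1)) (𝔪 ^ (k + s))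
      (𝔪 ^ t) (by rw [← pow_add, add_assoc, hst]) := by
  induction k with
  | zero => simpa [congruenceSubmonoid] using hh
  | succ k ih =>
    have hle : ∀ a b c : ℕ, c ≤ a + b → 𝔪 ^ a * 𝔪 ^ b ≤ 𝔪 ^ c := fun a b c habc => by
      rw [← pow_add]; exact Ideal.pow_le_pow_right habc
    have hle' : ∀ b c : ℕ, c ≤ b + 1 → 𝔪 * 𝔪 ^ b ≤ 𝔪 ^ c := fun b c habc => by
      rw [← pow_succ']; exact Ideal.pow_le_pow_right habc
    rw [show 2 * (k + 1) = 2 * k + 1 + 1 by ring, Function.iterate_succ_apply',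
      Function.iterate_succ_apply']
    set h₀ := (conjProd γ L)^[2 * k] h
    have m1 := conjProd_mem_congruenceSubmonoid ρ hγ L ih
    have x1 := conjProd_offDiag ρ hγ L (J := 𝔪 ^ (k + 1 + s)) (hle _ _ _ (by lia))
      (hle' _ _ (by lia)) hL' ih
    have m2 : ρ (conjProd γ L h₀) ∈ congruenceSubmonoid i j hij (𝔪 ^ (k + 1)) (𝔪 ^ (k + 1 + s))
        (𝔪 ^ t) (hle _ _ _ (by lia)) := ⟨m1.1, m1.2.1, x1, m1.2.2.2⟩
    have m3 := conjProd_mem_congruenceSubmonoid ρ hγ L m2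
    have x3 := conjProd_diag ρ hγ L (J := 𝔪 ^ (k + 1 + 1)) (hle _ _ _ (by lia))
      (hle _ _ _ (by lia)) (hle' _ _ (by lia)) hL m2
    exact ⟨x3.1, x3.2, m3.2.2.1, m3.2.2.2⟩

end Congruence

/-! ### Locally trivial cocycles -/

section Cocycle

variable {Γ M Λ : Type*} [Group Γ] [AddCommGroup M] [DistribMulAction Γ M] [CommRing Λ]
  {e : M ≃+ (Fin 2 → Λ)} {ρ : Γ →* Matrix (Fin 2) (Fin 2) Λ} {γ : Γ} {d : Fin 2 → Λˣ}

/-- If a cocycle vanishes at `γ`, then it is compatible with conjugation by the powers of `γ`. -/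
theorem cocycle_conj {Z : Γ → M} (hZ : ∀ s t, Z (s * t) = Z s + s • Z t) (hγ : Z γ = 0) (l : ℕ)
    (h : Γ) : Z (γ ^ l * h * (γ ^ l)⁻¹) = γ ^ l • Z h := by
  have h1 : Z 1 = 0 := by simpa using hZ 1 1
  have hpow : Z (γ ^ l) = 0 := by
    induction l with
    | zero => simpa using h1
    | succ l ih => rw [pow_succ, hZ, ih, hγ, smul_zero, add_zero]
  have hinv : Z (γ ^ l)⁻¹ = 0 := by
    have := hZ (γ ^ l)⁻¹ (γ ^ l)
    rwa [inv_mul_cancel, h1, hpow, smul_zero, add_zero, eq_comm] at this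
  rw [hZ, hZ, hpow, hinv, smul_zero, add_zero, zero_add]

/-- One step of the `𝔪`-adic induction. The `i`-th coordinate of the value at `h` is, modulo a
deeper ideal, the one of the value at a unipotent matrix `h'` such that `(h' - 1) M` has zero
`i`-th coordinate; this is where local triviality is used. -/
theorem locCocycle_coord_mem {𝔪 : Ideal Λ} {n : ℕ} (hn : 𝔪 ^ n = ⊥)
    (he : ∀ (s : Γ) (m : M), e (s • m) = (ρ s).mulVec (e m))
    (hγ : ρ γ = Matrix.diagonal fun r => (d r : Λ)) {N : Subgroup Γ} (hN : N.Normal)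
    {i j : Fin 2} (hij : i ≠ j) {s t : ℕ} (hst : s + t = 1)
    (hNρ : ∀ h ∈ N, ρ h i i - 1 ∈ 𝔪 ∧ ρ h j j - 1 ∈ 𝔪 ∧ ρ h i j ∈ 𝔪 ^ s ∧ ρ h j i ∈ 𝔪 ^ t)
    {L : List ℕ} (hL1 : (L.map ((d i : Λ) ^ ·)).sum - 1 ∈ 𝔪) (hL : (L.length : Λ) ∈ 𝔪)
    (hL' : (L.map ((((d i * (d j)⁻¹ : Λˣ) : Λ)) ^ ·)).sum ∈ 𝔪)
    {Z : Γ → M} (hZ : Z ∈ locCocycles Γ M) (hZγ : Z γ = 0) {k : ℕ}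
    (hi : ∀ h ∈ N, e (Z h) i ∈ 𝔪 ^ k) (hj : ∀ h ∈ N, e (Z h) j ∈ 𝔪 ^ (k + t)) :
    ∀ h ∈ N, e (Z h) i ∈ 𝔪 ^ (k + 1) := by
  obtain ⟨hZ, hloc⟩ := hZ
  have hΨN : ∀ h ∈ N, conjProd γ L h ∈ N := fun h hh => by
    refine N.list_prod_mem fun x hx => ?_
    obtain ⟨l, -, rfl⟩ := List.mem_map.1 hx
    exact hN.conj_mem h hh _
  have hstep : ∀ h ∈ N, e (Z (conjProd γ L h)) i - e (Z h) i ∈ 𝔪 ^ (k + 1) := by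
    intro h hh
    have key := conjProd_sub_mul_mem (J := 𝔪 ^ (k + 1)) (γ := γ) L N.toSubmonoid
      (fun l h hh => hN.conj_mem h hh _) (fun s => e (Z s) i) (d i : Λ)
      (by simp [show Z 1 = 0 by simpa using hZ 1 1]) (fun x hx y hy => by
        have e1 : e (Z (x * y)) i - (e (Z x) i + e (Z y) i) =
            (ρ x i i - 1) * e (Z y) i + ρ x i j * e (Z y) j := by
          rw [hZ, map_add, he, Pi.add_apply, Matrix.mulVec_apply_fin_two hij]; ring
        rw [e1]
        refine Ideal.add_mem _ ?_ ?_
        · rw [pow_succ']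
          exact Ideal.mul_mem_mul (hNρ x hx).1 (hi y hy)
        · rw [← hst, show k + (s + t) = s + (k + t) by ring, pow_add]
          exact Ideal.mul_mem_mul (hNρ x hx).2.2.1 (hj y hy))
      (fun l h _ => by
        rw [cocycle_conj hZ hZγ, he, map_pow, hγ, Matrix.diagonal_pow, Matrix.mulVec_diagonal]
        simp) hh
    have h2 : ((L.map ((d i : Λ) ^ ·)).sum - 1) * e (Z h) i ∈ 𝔪 ^ (k + 1) := by
      rw [pow_succ']
      exact Ideal.mul_mem_mul hL1 (hi h hh)
    convert Ideal.add_mem _ key h2 using 1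
    ring
  intro h hh
  have hiter : ∀ r : ℕ, (conjProd γ L)^[r] h ∈ N ∧
      e (Z ((conjProd γ L)^[r] h)) i - e (Z h) i ∈ 𝔪 ^ (k + 1) := by
    intro r
    induction r with
    | zero => simpa using hh
    | succ r ih =>
      rw [Function.iterate_succ_apply']
      refine ⟨hΨN _ ih.1, ?_⟩
      convert Ideal.add_mem _ (hstep _ ih.1) ih.2 using 1
      ring
  have hlim := conjProd_iterate_mem ρ hst hγ hij L hL hL' (hNρ h hh) n
  have hzero : ∀ r, 𝔪 ^ (n + r) = ⊥ := fun r => by rw [pow_add, hn, Ideal.bot_mul]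
  obtain ⟨h1, -, h3, -⟩ := hlim
  rw [hzero, Ideal.mem_bot] at h1 h3
  obtain ⟨m, hm⟩ := hloc ((conjProd γ L)^[2 * n] h)
  have hval : e (Z ((conjProd γ L)^[2 * n] h)) i = 0 := by
    rw [hm, map_sub, he, Pi.sub_apply, Matrix.mulVec_apply_fin_two hij, h3, sub_eq_zero.1 h1]
    ring
  have := (hiter (2 * n)).2
  rw [hval, zero_sub] at this
  exact neg_mem_iff.1 this

/-- The vanishing of the first local cohomology group, in coordinates. The group `Γ` is generated
by a normal subgroup `N`, lower unipotent modulo `𝔪 = ker red`, and by an element `γ` that is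
diagonal with eigenvalues `d 0` and `d 1`. -/
theorem locCocycles_le_oneCoboundaries (p : ℕ) [Fact p.Prime] {F : Type*} [Field F] [Finite F]
    [CharP F p] (red : Λ →+* F) {n : ℕ} (hn : RingHom.ker red ^ n = ⊥)
    (he : ∀ (s : Γ) (m : M), e (s • m) = (ρ s).mulVec (e m))
    (hγ : ρ γ = Matrix.diagonal fun r => (d r : Λ)) {N : Subgroup Γ} (hN : N.Normal)
    (hgen : N ⊔ Subgroup.zpowers γ = ⊤)
    (hNρ : ∀ h ∈ N, red (ρ h 0 0) = 1 ∧ red (ρ h 1 1) = 1 ∧ red (ρ h 0 1) = 0)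
    (h0 : red (d 0) ≠ 1) (h1 : red (d 1) ≠ 1)
    (h01 : ¬ IsGaloisConj (red (d 0)) (red (d 0 * (d 1)⁻¹ : Λˣ)))
    (h10 : ¬ IsGaloisConj (red (d 1)) (red (d 1 * (d 0)⁻¹ : Λˣ))) :
    locCocycles Γ M ≤ oneCoboundaries Γ M := by
  intro Z hZ
  obtain ⟨m, hm⟩ := hZ.2 γ
  -- Subtracting a coboundary makes the cocycle vanish at `γ`.
  have hB : (fun s => s • m - m) ∈ oneCoboundaries Γ M := ⟨m, fun _ => rfl⟩
  have hB' : (fun s => s • m - m) ∈ locCocycles Γ M :=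
    ⟨fun s t => by simp only [mul_smul, smul_sub]; abel, fun s => ⟨m, rfl⟩⟩
  obtain ⟨Y, rfl⟩ : ∃ Y, Z = Y + fun s => s • m - m := ⟨Z - fun s => s • m - m, by simp⟩
  have hY : Y ∈ locCocycles Γ M := by simpa using (locCocycles Γ M).sub_mem hZ hB'
  have hYγ : Y γ = 0 := by simpa using hm
  suffices Y = 0 by rw [this, zero_add]; exact hB
  have hlift : ∀ {x : Λˣ} {L : List ℕ}, red (L.map ((x : Λ) ^ ·)).sum =
      (L.map ((red x) ^ ·)).sum := by
    intro x L
    rw [map_list_sum, List.map_map]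
    congr 1
    exact List.map_congr_left fun l _ => by simp
  obtain ⟨L, hL1, hL2, hL3⟩ := exists_list_sum_pow_separating p h0 h01
  obtain ⟨L', hL1', hL2', hL3'⟩ := exists_list_sum_pow_separating p h1 h10
  have hdeep : ∀ k, ∀ h ∈ N, e (Y h) 0 ∈ RingHom.ker red ^ k ∧ e (Y h) 1 ∈ RingHom.ker red ^ k := by
    intro k
    induction k with
    | zero => simp
    | succ k ih =>
      have c0 := locCocycle_coord_mem hn he hγ hN (i := 0) (j := 1) (by decide) (s := 1) (t := 0)
        rfl (fun h hh => by
          simp only [RingHom.mem_ker, pow_one, pow_zero, map_sub, map_one, Ideal.one_eq_top]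
          exact ⟨by simp [(hNρ h hh).1], by simp [(hNρ h hh).2.1], (hNρ h hh).2.2, trivial⟩)
        (L := L) (by simp [RingHom.mem_ker, hlift, hL1]) (by simp [RingHom.mem_ker, hL2])
        (by rw [RingHom.mem_ker, hlift, hL3]) hY hYγ (fun h hh => (ih h hh).1)
        (fun h hh => (ih h hh).2)
      have c1 := locCocycle_coord_mem hn he hγ hN (i := 1) (j := 0) (by decide) (s := 0) (t := 1)
        rfl (fun h hh => by
          simp only [RingHom.mem_ker, pow_one, pow_zero, map_sub, map_one, Ideal.one_eq_top]
          exact ⟨by simp [(hNρ h hh).2.1], by simp [(hNρ h hh).1], trivial, (hNρ h hh).2.2⟩)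
        (L := L') (by simp [RingHom.mem_ker, hlift, hL1']) (by simp [RingHom.mem_ker, hL2'])
        (by rw [RingHom.mem_ker, hlift, hL3']) hY hYγ (fun h hh => (ih h hh).2) c0
      exact fun h hh => ⟨c0 h hh, c1 h hh⟩
  have hYN : ∀ h ∈ N, Y h = 0 := by
    intro h hh
    have := hdeep n h hh
    rw [hn, Ideal.mem_bot, Ideal.mem_bot] at this
    apply e.injective
    rw [map_zero]
    funext r
    fin_cases r
    exacts [this.1, this.2]
  have hYone : Y 1 = 0 := by simpa using hY.1 1 1
  let K : Subgroup Γ :=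
    { carrier := {s | Y s = 0}
      one_mem' := hYone
      mul_mem' := fun {s t} (hs : Y s = 0) (ht : Y t = 0) => by
        change Y (s * t) = 0
        rw [hY.1, hs, ht, smul_zero, add_zero]
      inv_mem' := fun {s} (hs : Y s = 0) => by
        change Y s⁻¹ = 0
        have := hY.1 s⁻¹ s
        rwa [inv_mul_cancel, hYone, hs, smul_zero, add_zero, eq_comm] at this }
  have hK : (⊤ : Subgroup Γ) ≤ K := by
    rw [← hgen]
    exact sup_le hYN (by rwa [Subgroup.zpowers_le])
  funext s
  exact hK (Subgroup.mem_top s)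

end Cocycle

/-! ### Lifting eigenbases from the residue field -/

section Lift

variable {Λ F : Type*} [CommRing Λ] [Field F] (red : Λ →+* F)

theorem isUnit_of_map_ne_zero {n : ℕ} (hn : RingHom.ker red ^ n = ⊥)
    (hred : Function.Surjective red) {x : Λ} (hx : red x ≠ 0) : IsUnit x := by
  obtain ⟨y, hy⟩ := hred (red x)⁻¹
  have hnil : IsNilpotent (x * y - 1) := by
    refine ⟨n, ?_⟩
    have : x * y - 1 ∈ RingHom.ker red := by
      rw [RingHom.mem_ker, map_sub, map_mul, hy, mul_inv_cancel₀ hx, map_one, sub_self]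
    simpa [hn] using Ideal.pow_mem_pow this n
  have hu := hnil.isUnit_add_one
  rw [sub_add_cancel] at hu
  exact isUnit_of_mul_isUnit_left hu

/-- Matrices that are congruent to `1` modulo the nilpotent ideal `ker red` have `p`-power order. -/
theorem Matrix.pow_prime_pow_eq_one (p : ℕ) [hp : Fact p.Prime] [CharP F p] {n : ℕ}
    (hn : RingHom.ker red ^ n = ⊥) {ι : Type*} [Fintype ι] [DecidableEq ι] {B : Matrix ι ι Λ}
    (hB : red.mapMatrix B = 1) : B ^ p ^ n = 1 := by
  have hmem : ∀ I J : Ideal Λ, ∀ X Y : Matrix ι ι Λ, (∀ r c, X r c ∈ I) → (∀ r c, Y r c ∈ J) →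
      ∀ r c, (X * Y) r c ∈ I * J := fun I J X Y hX hY r c => by
    rw [Matrix.mul_apply]
    exact Ideal.sum_mem _ fun l _ => Ideal.mul_mem_mul (hX r l) (hY l c)
  have key : ∀ k : ℕ, ∀ r c, (B ^ p ^ k - 1) r c ∈ RingHom.ker red ^ (k + 1) := by
    intro k
    induction k with
    | zero =>
      intro r c
      have := congrFun (congrFun hB r) c
      rw [RingHom.mapMatrix_apply, Matrix.map_apply] at this
      rw [zero_add, pow_one, pow_zero, pow_one, RingHom.mem_ker, Matrix.sub_apply, map_sub, this]
      rw [Matrix.one_apply, Matrix.one_apply]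
      split_ifs <;> simp
    | succ k ih =>
      set Y := B ^ p ^ k - 1 with hY
      have hYpow : ∀ m : ℕ, ∀ r c, (Y ^ (m + 1)) r c ∈ RingHom.ker red ^ ((k + 1) * (m + 1)) := by
        intro m
        induction m with
        | zero => simpa using ih
        | succ m ihm =>
          intro r c
          rw [pow_succ, Nat.mul_add_one (k + 1) (m + 1), pow_add]
          exact hmem _ _ _ _ ihm ih r c
      obtain ⟨R, hR⟩ := (Commute.one_left Y).exists_add_pow_prime_eq hp.out
      have e : B ^ p ^ (k + 1) - 1 = Y ^ p + (p : Matrix ι ι Λ) * (Y * R) := by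
        rw [pow_succ, pow_mul, show B ^ p ^ k = 1 + Y by rw [hY]; abel, hR, one_pow, mul_one]
        simp only [mul_assoc]
        abel
      intro r c
      rw [e, Matrix.add_apply]
      refine Ideal.add_mem _ ?_ ?_
      · obtain ⟨m, hm⟩ : ∃ m, p = m + 1 + 1 := ⟨p - 2, by have := hp.out.two_le; omega⟩
        rw [hm]
        exact Ideal.pow_le_pow_right (by nlinarith) (hYpow (m + 1) r c)
      · rw [← nsmul_eq_mul, Matrix.smul_apply, nsmul_eq_mul, pow_succ' _ (k + 1)]
        refine Ideal.mul_mem_mul (by simp [RingHom.mem_ker]) ?_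
        simpa using hmem _ ⊤ Y R ih (fun _ _ => trivial) r c
  ext r c
  have := key n r c
  rw [pow_succ, hn, Ideal.bot_mul, Ideal.mem_bot, Matrix.sub_apply, sub_eq_zero] at this
  exact this

/-- An eigenbasis over the residue field lifts to an eigenbasis, once `σ` is replaced by a power
of it with the same reduction. With `S` and `D` of order dividing `q - 1`, the new basis is
the sum over `k < q - 1` of the matrices `S ^ k * Q₁ * D ^ (-k)`, where `Q₁` is any lift of `Q₀`; its
reduction is `(q - 1) Q₀ = -Q₀`. -/
theorem exists_diagonal_lift (p : ℕ) [hp : Fact p.Prime] [Finite F] [CharP F p] {n : ℕ}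
    (hn : RingHom.ker red ^ n = ⊥) (hred : Function.Surjective red) {Γ : Type*} [Group Γ]
    (ρ : Γ →* Matrix (Fin 2) (Fin 2) Λ) (σ : Γ) {a : Fin 2 → F} (ha : ∀ r, a r ≠ 0)
    {Q₀ : Matrix (Fin 2) (Fin 2) F} (hQ₀ : Q₀.det ≠ 0)
    (h : red.mapMatrix (ρ σ) * Q₀ = Q₀ * Matrix.diagonal a) :
    ∃ (t : ℕ) (Q : Matrix (Fin 2) (Fin 2) Λ) (d : Fin 2 → Λˣ), IsUnit Q ∧
      red.mapMatrix Q = -Q₀ ∧ (∀ r, red (d r) = a r) ∧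
      ρ (σ ^ Nat.card F ^ t) * Q = Q * Matrix.diagonal fun r => (d r : Λ) := by
  have := Fintype.ofFinite F
  set q := Nat.card F with hq
  have hqF : Fintype.card F = q := Fintype.card_eq_nat_card
  have hq1 : 1 ≤ q := Nat.card_pos
  obtain ⟨f, hf⟩ : ∃ f : ℕ, p ^ n ∣ q ^ n ∧ q = p ^ f := by
    obtain ⟨f, -, hf⟩ := FiniteField.card F p
    refine ⟨f, pow_dvd_pow_of_dvd ?_ n, hqF ▸ hf⟩
    rw [← hqF, hf]
    exact dvd_pow_self _ f.ne_zero
  have hone : ∀ B : Matrix (Fin 2) (Fin 2) Λ, red.mapMatrix B = 1 → B ^ q ^ n = 1 := by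
    intro B hB
    obtain ⟨c, hc⟩ := hf.1
    rw [hc, pow_mul, Matrix.pow_prime_pow_eq_one red p hn hB, one_pow]
  -- Teichmüller lifts of the eigenvalues.
  choose a' ha' using fun r => hred (a r)
  have hu : ∀ r, IsUnit (a' r) := fun r =>
    isUnit_of_map_ne_zero red hn hred (by rw [ha']; exact ha r)
  let d : Fin 2 → Λˣ := fun r => (hu r).unit ^ q ^ n
  have hapow : ∀ (r : Fin 2) (t : ℕ), a r ^ q ^ t = a r := fun r t => by
    rw [← hqF]; exact FiniteField.pow_card_pow t (a r)
  have haq : ∀ r, a r ^ (q - 1) = 1 := fun r => by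
    rw [← hqF]; exact FiniteField.pow_card_sub_one_eq_one _ (ha r)
  have hd : ∀ r, red (d r) = a r := fun r => by
    simp [d, ha', hapow]
  have hdq : ∀ r, d r ^ (q - 1) = 1 := by
    have h1 : (Matrix.diagonal fun r => a' r ^ (q - 1)) ^ q ^ n = 1 := by
      refine hone _ ?_
      rw [RingHom.mapMatrix_apply, Matrix.diagonal_map (map_zero red)]
      simp [ha', haq]
    intro r
    have h2 := congrFun (congrFun h1 r) r
    rw [Matrix.diagonal_pow, Matrix.diagonal_apply_eq, Matrix.one_apply_eq] at h2
    ext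
    rw [← pow_mul, mul_comm, pow_mul]
    simpa using h2
  let E : Matrix (Fin 2) (Fin 2) Λ := Matrix.diagonal fun r => (((d r)⁻¹ : Λˣ) : Λ)
  let D : Matrix (Fin 2) (Fin 2) Λ := Matrix.diagonal fun r => (d r : Λ)
  have hED : E * D = 1 := by
    simp [E, D, Matrix.diagonal_mul_diagonal]
  have hEq : E ^ (q - 1) = 1 := by
    simp only [E, Matrix.diagonal_pow, ← Matrix.diagonal_one]
    congr 1
    funext r
    rw [Pi.pow_apply, ← Units.val_pow_eq_pow_val, inv_pow, hdq, inv_one, Units.val_one]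
  set T := red.mapMatrix (ρ σ) with hT
  have hTdiag : ∀ k : ℕ, T ^ k * Q₀ = Q₀ * Matrix.diagonal fun r => a r ^ k := by
    intro k
    induction k with
    | zero => simp
    | succ k ih =>
      rw [pow_succ, mul_assoc, h, ← mul_assoc, ih, mul_assoc, Matrix.diagonal_mul_diagonal]
      simp only [pow_succ]
  have hQ₀u : IsUnit Q₀ := (Matrix.isUnit_iff_isUnit_det _).2 (isUnit_iff_ne_zero.2 hQ₀)
  set S := ρ (σ ^ q ^ n) with hS
  have hSq : S ^ (q - 1) = 1 := by
    rw [hS, map_pow, ← pow_mul, mul_comm, pow_mul]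
    refine hone _ (hQ₀u.mul_right_cancel ?_)
    rw [map_pow, ← hT, hTdiag]
    simp [haq]
  have hredS : red.mapMatrix S * Q₀ * red.mapMatrix E = Q₀ := by
    rw [hS, map_pow, map_pow, ← hT, hTdiag, mul_assoc, RingHom.mapMatrix_apply,
      Matrix.diagonal_map (map_zero red), Matrix.diagonal_mul_diagonal]
    have : (fun r => a r ^ q ^ n * red (((d r)⁻¹ : Λˣ) : Λ)) = fun _ => 1 := by
      funext r
      rw [hapow, ← hd, ← map_mul, Units.mul_inv, map_one]
    rw [this, Matrix.diagonal_one, mul_one]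
  choose Q₁ hQ₁ using fun r c => hred (Q₀ r c)
  have hQ₁' : red.mapMatrix (Matrix.of Q₁) = Q₀ := by
    ext r c
    simp [hQ₁]
  let s : ℕ → Matrix (Fin 2) (Fin 2) Λ := fun k => S ^ k * Matrix.of Q₁ * E ^ k
  have hs : ∀ k, S * s k * E = s (k + 1) := fun k => by
    simp only [s, pow_succ' S, pow_succ E, mul_assoc]
  let Q := ∑ k ∈ Finset.range (q - 1), s k
  have hSQE : S * Q * E = Q := by
    simp only [Q, Finset.mul_sum, Finset.sum_mul, hs]
    have h1 := Finset.sum_range_succ s (q - 1)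
    rw [Finset.sum_range_succ'] at h1
    have h2 : s (q - 1) = s 0 := by simp [s, hSq, hEq]
    rw [h2] at h1
    exact add_right_cancel h1
  have hreds : ∀ k, red.mapMatrix (s k) = Q₀ := by
    intro k
    induction k with
    | zero => simpa [s] using hQ₁'
    | succ k ih => rw [← hs, map_mul, map_mul, ih, hredS]
  have hredQ : red.mapMatrix Q = -Q₀ := by
    simp only [Q, map_sum, hreds, Finset.sum_const, Finset.card_range]
    have h0 : (q : F) = 0 := by rw [← hqF]; exact FiniteField.cast_card_eq_zero F
    rw [← Nat.cast_smul_eq_nsmul F, Nat.cast_sub hq1, h0]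
    simp
  refine ⟨n, Q, d, ?_, hredQ, hd, ?_⟩
  · rw [Matrix.isUnit_iff_isUnit_det]
    refine isUnit_of_map_ne_zero red hn hred ?_
    rw [RingHom.map_det, hredQ, Matrix.det_neg]
    simpa using hQ₀
  · calc S * Q = S * Q * (E * D) := by rw [hED, mul_one]
      _ = S * Q * E * D := (mul_assoc _ _ _).symm
      _ = Q * D := by rw [hSQE]

end Lift

/-! ### An eigenbasis adapted to a stable subspace -/

section Eigenbasis

variable {F : Type*} [Field F]

/-- A matrix over a finite field of order dividing `q - 1` is diagonalizable, and the second
vector of an eigenbasis can be taken in a given nonzero stable subspace. -/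
theorem exists_eigenbasis (p : ℕ) [hp : Fact p.Prime] [Finite F] [CharP F p]
    {B : Matrix (Fin 2) (Fin 2) F} (hB : B ^ (Nat.card F - 1) = 1) {l₁ l₂ : F}
    (hchar : B.charpoly = (Polynomial.X - Polynomial.C l₁) * (Polynomial.X - Polynomial.C l₂))
    {V : Submodule F (Fin 2 → F)} (hV : V ≠ ⊥) (hBV : ∀ x ∈ V, B.mulVec x ∈ V) :
    ∃ (Q : Matrix (Fin 2) (Fin 2) F) (a : Fin 2 → F),
      ((a 0 = l₁ ∧ a 1 = l₂) ∨ (a 0 = l₂ ∧ a 1 = l₁)) ∧ Q.det ≠ 0 ∧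
      B * Q = Q * Matrix.diagonal a ∧ Q.mulVec (Pi.single 1 1) ∈ V := by
  have := Fintype.ofFinite F
  have hCH : (B - Matrix.scalar _ l₂) * (B - Matrix.scalar _ l₁) = 0 := by
    have := Matrix.aeval_self_charpoly B
    rw [hchar, mul_comm] at this
    rw [map_mul, map_sub, map_sub, Polynomial.aeval_X, Polynomial.aeval_C,
      Polynomial.aeval_C] at this
    exact this
  have hsub : ∀ (l : F) (x : Fin 2 → F), (B - Matrix.scalar _ l).mulVec x = B.mulVec x - l • x := by
    intro l x
    rw [Matrix.sub_mulVec]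
    congr 1
    ext r
    simp [Matrix.mulVec_diagonal]
  obtain ⟨x, hxV, hx⟩ := V.ne_bot_iff.1 hV
  -- An eigenvector in the subspace: either `x` or `(B - l₁) x`.
  obtain ⟨v, a, b, hvV, hv, hBv, hab⟩ : ∃ (v : Fin 2 → F) (a b : F), v ∈ V ∧ v ≠ 0 ∧
      B.mulVec v = b • v ∧ ((a = l₁ ∧ b = l₂) ∨ (a = l₂ ∧ b = l₁)) := by
    by_cases h : B.mulVec x = l₁ • x
    · exact ⟨x, l₂, l₁, hxV, hx, h, .inr ⟨rfl, rfl⟩⟩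
    · refine ⟨B.mulVec x - l₁ • x, l₁, l₂, V.sub_mem (hBV x hxV) (V.smul_mem _ hxV),
        sub_ne_zero.2 h, ?_, .inl ⟨rfl, rfl⟩⟩
      rw [← sub_eq_zero, ← hsub, ← hsub, Matrix.mulVec_mulVec, hCH, Matrix.zero_mulVec]
  have hchar' : B.charpoly = (Polynomial.X - Polynomial.C a) * (Polynomial.X - Polynomial.C b) := by
    rcases hab with ⟨rfl, rfl⟩ | ⟨rfl, rfl⟩
    · exact hchar
    · rw [hchar, mul_comm]
  obtain ⟨w, hBw, hdet⟩ : ∃ w : Fin 2 → F, B.mulVec w = a • w ∧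
      (!![w 0, v 0; w 1, v 1] : Matrix (Fin 2) (Fin 2) F).det ≠ 0 := by
    by_cases hne : a = b
    -- `B = a + ν` with `ν ^ 2 = 0`, so that `B = B ^ q = a ^ q + ν ^ q = a`.
    · have hBa : B = Matrix.scalar _ a := by
        obtain ⟨f, -, hf⟩ := FiniteField.card F p
        have hqF : Fintype.card F = Nat.card F := Fintype.card_eq_nat_card
        have hq2 : 2 ≤ Nat.card F := by
          rw [← hqF]; exact Fintype.one_lt_card
        have hnil : (B - Matrix.scalar _ a) ^ 2 = 0 := by
          rw [pow_two]
          rcases hab with ⟨rfl, rfl⟩ | ⟨rfl, rfl⟩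
          · rw [hne] at hCH ⊢; exact hCH
          · rw [← hne] at hCH; exact hCH
        have hnil' : (B - Matrix.scalar _ a) ^ p ^ (f : ℕ) = 0 := by
          rw [← hf, hqF]
          obtain ⟨c, hc⟩ := Nat.exists_eq_add_of_le hq2
          rw [hc, pow_add, hnil, zero_mul]
        have hcomm : Commute (B - Matrix.scalar (Fin 2) a) (Matrix.scalar (Fin 2) a) :=
          (Matrix.scalar_commute a (fun r => Commute.all a r) _).symm
        have hpow := add_pow_char_pow_of_commute (p := p) (n := (f : ℕ)) hcomm
        rw [sub_add_cancel, hnil', zero_add, ← hf, ← map_pow, FiniteField.pow_card] at hpow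
        rw [← hpow, hqF]
        obtain ⟨c, hc⟩ := Nat.exists_eq_add_of_le hq2
        rw [show Nat.card F = Nat.card F - 1 + 1 by omega, pow_succ, hB, one_mul]
      have hBany : ∀ w : Fin 2 → F, B.mulVec w = a • w := fun w => by
        rw [← sub_eq_zero, ← hsub, hBa, sub_self, Matrix.zero_mulVec]
      by_cases h1 : v 1 = 0
      · refine ⟨Pi.single 1 1, hBany _, ?_⟩
        have h0 : v 0 ≠ 0 := fun h0 => hv (by ext r; fin_cases r <;> assumption)
        simpa [Matrix.det_fin_two] using h0
      · exact ⟨Pi.single 0 1, hBany _, by simpa [Matrix.det_fin_two] using h1⟩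
    · have hdet0 : (B - Matrix.scalar _ a).det = 0 := by
        have := Matrix.eval_charpoly B a
        rw [hchar'] at this
        have h2 : (Matrix.scalar (Fin 2) a - B).det = 0 := by rw [← this]; simp
        rw [← neg_sub, Matrix.det_neg, h2, mul_zero]
      obtain ⟨w, hw, hBw⟩ := Matrix.exists_mulVec_eq_zero_iff.2 hdet0
      rw [hsub, sub_eq_zero] at hBw
      refine ⟨w, hBw, fun h0 => ?_⟩
      obtain ⟨y, hy, hy0⟩ := Matrix.exists_mulVec_eq_zero_iff.2 h0
      have e1 : y 0 • w + y 1 • v = 0 := by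
        ext r
        have := congrFun hy0 r
        rw [Pi.add_apply, Pi.smul_apply, Pi.smul_apply, smul_eq_mul, smul_eq_mul,
          mul_comm (y 0), mul_comm (y 1)]
        fin_cases r <;> simpa [Matrix.mulVec, dotProduct, Fin.sum_univ_two] using this
      have e2 : y 0 • (a • w) + y 1 • (b • v) = 0 := by
        rw [← hBw, ← hBv, ← Matrix.mulVec_smul, ← Matrix.mulVec_smul, ← Matrix.mulVec_add, e1,
          Matrix.mulVec_zero]
      have e3 : (y 0 * (a - b)) • w = 0 := by
        have : (y 0 * (a - b)) • w =
            (y 0 • (a • w) + y 1 • (b • v)) - b • (y 0 • w + y 1 • v) := by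
          ext r; simp only [Pi.smul_apply, Pi.add_apply, Pi.sub_apply, smul_eq_mul]; ring
        rw [this, e1, e2, smul_zero, sub_zero]
      have hy00 : y 0 = 0 := by
        rcases smul_eq_zero.1 e3 with h | h
        · exact (mul_eq_zero.1 h).resolve_right (sub_ne_zero.2 hne)
        · exact absurd h hw
      rw [hy00, zero_smul, zero_add] at e1
      have hy1 := (smul_eq_zero.1 e1).resolve_right hv
      exact hy (by ext r; fin_cases r <;> assumption)
  refine ⟨!![w 0, v 0; w 1, v 1], ![a, b], ?_, hdet, ?_, ?_⟩
  · simpa using hab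
  · ext r c
    have h0 := congrFun hBw r
    have h1 := congrFun hBv r
    simp only [Matrix.mulVec, dotProduct, Fin.sum_univ_two, Pi.smul_apply, smul_eq_mul] at h0 h1
    rw [Matrix.mul_diagonal, Matrix.mul_apply, Fin.sum_univ_two]
    fin_cases c
    · fin_cases r <;> simpa [mul_comm a] using h0
    · fin_cases r <;> simpa [mul_comm b] using h1
  · convert hvV using 1
    ext r
    fin_cases r <;> simp

end Eigenbasis

/-! ### Vanishing of local cohomology -/

section Vanishing

variable {Γ M Λ F : Type*} [Group Γ] [AddCommGroup M] [DistribMulAction Γ M] [CommRing Λ]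
  [Field F]

/-- The vanishing of the first local cohomology group, with all conditions imposed on the reduction
of `ρ` modulo `ker red`: `N` acts on the reduction through elements of `p`-power order that have
a common fixed vector, and `Γ` is generated by `N` and `σ`. -/
theorem locCocycles_le_oneCoboundaries_of_residual (p : ℕ) [Fact p.Prime] [Finite F] [CharP F p]
    {e : M ≃+ (Fin 2 → Λ)} {ρ : Γ →* Matrix (Fin 2) (Fin 2) Λ} (red : Λ →+* F)
    (hred : Function.Surjective red) {n : ℕ} (hn : RingHom.ker red ^ n = ⊥)
    (he : ∀ (s : Γ) (m : M), e (s • m) = (ρ s).mulVec (e m))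
    {N : Subgroup Γ} (hN : N.Normal) {σ : Γ} (hgen : N ⊔ Subgroup.zpowers σ = ⊤)
    (hσN : σ ^ (Nat.card F - 1) ∈ N) (hσ : red.mapMatrix (ρ σ) ^ (Nat.card F - 1) = 1)
    (hNp : ∀ h ∈ N, ∃ k : ℕ, red.mapMatrix (ρ h) ^ p ^ k = 1)
    (hfix : ∃ x : Fin 2 → F, x ≠ 0 ∧ ∀ h ∈ N, (red.mapMatrix (ρ h)).mulVec x = x)
    {l₁ l₂ : F} (hl₁ : l₁ ≠ 0) (hl₂ : l₂ ≠ 0)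
    (hchar : (red.mapMatrix (ρ σ)).charpoly =
      (Polynomial.X - Polynomial.C l₁) * (Polynomial.X - Polynomial.C l₂))
    (h₁ : l₁ ≠ 1) (h₂ : l₂ ≠ 1) (h₁₂ : ¬ IsGaloisConj l₁ (l₁ * l₂⁻¹))
    (h₂₁ : ¬ IsGaloisConj l₂ (l₂ * l₁⁻¹)) :
    locCocycles Γ M ≤ oneCoboundaries Γ M := by
  let V : Submodule F (Fin 2 → F) :=
    { carrier := {x | ∀ h ∈ N, (red.mapMatrix (ρ h)).mulVec x = x}
      add_mem' := fun hx hy h hh => by rw [Matrix.mulVec_add, hx h hh, hy h hh]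
      zero_mem' := fun h _ => Matrix.mulVec_zero _
      smul_mem' := fun c x hx h hh => by rw [Matrix.mulVec_smul, hx h hh] }
  have hV : V ≠ ⊥ := by
    obtain ⟨x, hx, hxN⟩ := hfix
    exact V.ne_bot_iff.2 ⟨x, hxN, hx⟩
  have hBV : ∀ x ∈ V, (red.mapMatrix (ρ σ)).mulVec x ∈ V := by
    intro x hx h hh
    have := hx (σ⁻¹ * h * σ) (by simpa using hN.conj_mem h hh σ⁻¹)
    conv_rhs => rw [← this]
    rw [Matrix.mulVec_mulVec, Matrix.mulVec_mulVec, ← map_mul, ← map_mul, ← map_mul, ← map_mul,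
      show σ * (σ⁻¹ * h * σ) = h * σ by group]
  obtain ⟨Q₀, a, ha, hQ₀, hQ₀σ, hQ₀V⟩ := exists_eigenbasis p hσ hchar hV hBV
  have ha0 : ∀ r, a r ≠ 0 := by
    intro r
    rcases ha with ⟨h0, h1⟩ | ⟨h0, h1⟩ <;> fin_cases r <;> simp [h0, h1, hl₁, hl₂]
  obtain ⟨t, Q, d, hQ, hQQ₀, hd, hQσ⟩ :=
    exists_diagonal_lift red p hn hred ρ σ ha0 hQ₀ hQ₀σ
  obtain ⟨W, hQW, hWQ⟩ := isUnit_iff_exists.1 hQ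
  -- The coordinates in the lifted eigenbasis.
  let e' : M ≃+ (Fin 2 → Λ) := e.trans
    { toFun := W.mulVec
      invFun := Q.mulVec
      left_inv := fun x => by rw [Matrix.mulVec_mulVec, hQW, Matrix.one_mulVec]
      right_inv := fun x => by rw [Matrix.mulVec_mulVec, hWQ, Matrix.one_mulVec]
      map_add' := Matrix.mulVec_add W }
  let ρ' : Γ →* Matrix (Fin 2) (Fin 2) Λ :=
    { toFun := fun s => W * ρ s * Q
      map_one' := by rw [map_one, mul_one, hWQ]
      map_mul' := fun s s' => by
        calc W * ρ (s * s') * Q = W * ρ s * 1 * ρ s' * Q := by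
              rw [map_mul]; simp only [mul_assoc, one_mul]
          _ = _ := by rw [← hQW]; simp only [mul_assoc] }
  have he' : ∀ (s : Γ) (m : M), e' (s • m) = (ρ' s).mulVec (e' m) := by
    intro s m
    change W.mulVec (e (s • m)) = (W * ρ s * Q).mulVec (W.mulVec (e m))
    rw [he, Matrix.mulVec_mulVec, Matrix.mulVec_mulVec, mul_assoc (W * ρ s), hQW, mul_one]
  have hγ : ρ' (σ ^ Nat.card F ^ t) = Matrix.diagonal fun r => (d r : Λ) := by
    change W * ρ (σ ^ Nat.card F ^ t) * Q = _
    rw [mul_assoc, hQσ, ← mul_assoc, hWQ, one_mul]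
  have hgen' : N ⊔ Subgroup.zpowers (σ ^ Nat.card F ^ t) = ⊤ := by
    rw [← top_le_iff, ← hgen]
    refine sup_le le_sup_left ?_
    rw [Subgroup.zpowers_le]
    obtain ⟨c, hc⟩ : Nat.card F - 1 ∣ Nat.card F ^ t - 1 := by
      simpa using Nat.sub_dvd_pow_sub_pow (Nat.card F) 1 t
    have h1 : σ ^ (Nat.card F ^ t - 1) ∈ N := by
      rw [hc, pow_mul]; exact N.pow_mem hσN c
    have h2 : (σ ^ (Nat.card F ^ t - 1))⁻¹ * σ ^ Nat.card F ^ t = σ := by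
      have hpos : 1 ≤ Nat.card F ^ t := Nat.one_le_pow _ _ Nat.card_pos
      rw [inv_mul_eq_iff_eq_mul, ← pow_succ, Nat.sub_add_cancel hpos]
    have h3 : (σ ^ (Nat.card F ^ t - 1))⁻¹ * σ ^ Nat.card F ^ t ∈
        N ⊔ Subgroup.zpowers (σ ^ Nat.card F ^ t) :=
      mul_mem (inv_mem (Subgroup.mem_sup_left h1))
        (Subgroup.mem_sup_right (Subgroup.mem_zpowers _))
    rwa [h2] at h3
  have hQ₀inj : Function.Injective Q₀.mulVec :=
    Matrix.mulVec_injective_of_isUnit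
      ((Matrix.isUnit_iff_isUnit_det _).2 (isUnit_iff_ne_zero.2 hQ₀))
  have hQ₀u : IsUnit Q₀ := (Matrix.isUnit_iff_isUnit_det _).2 (isUnit_iff_ne_zero.2 hQ₀)
  have hNρ : ∀ h ∈ N, red (ρ' h 0 0) = 1 ∧ red (ρ' h 1 1) = 1 ∧ red (ρ' h 0 1) = 0 := by
    intro h hh
    set C := red.mapMatrix (ρ' h) with hC
    have hconj : Q₀ * C = red.mapMatrix (ρ h) * Q₀ := by
      have h1 : Q * ρ' h = ρ h * Q := by
        change Q * (W * ρ h * Q) = _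
        rw [mul_assoc, ← mul_assoc, hQW, one_mul]
      have h2 := congrArg red.mapMatrix h1
      rw [map_mul, map_mul, hQQ₀, neg_mul, mul_neg, neg_inj] at h2
      exact h2
    have hcol : C.mulVec (Pi.single 1 1) = Pi.single 1 1 := by
      apply hQ₀inj
      rw [Matrix.mulVec_mulVec, hconj, ← Matrix.mulVec_mulVec]
      exact hQ₀V h hh
    have h01 : C 0 1 = 0 := by simpa using congrFun hcol 0
    have h11 : C 1 1 = 1 := by simpa using congrFun hcol 1
    obtain ⟨k, hk⟩ := hNp h hh
    have hCk : C ^ p ^ k = 1 := by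
      have := (show SemiconjBy Q₀ C (red.mapMatrix (ρ h)) from hconj).pow_right (p ^ k)
      rw [SemiconjBy, hk, one_mul] at this
      exact hQ₀u.mul_left_cancel (by rw [this, mul_one])
    have hpow : ∀ m : ℕ, (C ^ m) 0 0 = C 0 0 ^ m := by
      intro m
      induction m with
      | zero => simp
      | succ m ih => rw [pow_succ', Matrix.mul_apply, Fin.sum_univ_two, h01, ih, pow_succ']; ring
    have h00 : C 0 0 = 1 := by
      have h3 : C 0 0 ^ p ^ k = 1 := by rw [← hpow, hCk, Matrix.one_apply_eq]
      have h4 : (C 0 0 - 1) ^ p ^ k = 0 := by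
        rw [sub_pow_char_pow, h3, one_pow, sub_self]
      exact sub_eq_zero.1 (eq_zero_of_pow_eq_zero h4)
    exact ⟨h00, h11, h01⟩
  have hdinv : ∀ r s, red (d r * (d s)⁻¹ : Λˣ) = a r * (a s)⁻¹ := by
    intro r s
    rw [Units.val_mul, map_mul, map_units_inv, hd, hd]
  refine locCocycles_le_oneCoboundaries p red hn he' hγ hN hgen' hNρ ?_ ?_ ?_ ?_ <;>
    simp only [hdinv, hd] <;> rcases ha with ⟨h0, h1⟩ | ⟨h0, h1⟩ <;>
    simpa only [h0, h1]

end Vanishing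

/-! ### The order of the second eigenvalue -/

/-- An automorphism `τ` with `τ a = a / b` satisfies `τ b = b ^ 2`, because it fixes `a b`, which lies
in the prime field. Since `τ ^ f = 1`, the order of `b` divides `2 ^ f - 1`. -/
theorem orderOf_le_of_isGaloisConj (p : ℕ) [Fact p.Prime] {F : Type*} [Field F] [Finite F]
    [CharP F p] {f : ℕ} (hf : Nat.card F = p ^ f) {a b : Fˣ} (hab : (a * b) ^ (p - 1) = 1)
    (hconj : IsGaloisConj (a : F) ↑(a * b⁻¹)) : orderOf b ≤ 2 ^ f := by
  have := Fintype.ofFinite F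
  let _ := ZMod.algebra F p
  obtain ⟨τ, hτ⟩ := hconj
  have hp := (Fact.out : p.Prime)
  have hδ : ((a * b : Fˣ) : F) ∈ (⊥ : Subfield F) := by
    rw [Subfield.mem_bot_iff_pow_eq_self F p]
    have h1 : (a * b) ^ p = a * b := by
      conv_lhs => rw [← Nat.sub_add_cancel hp.one_le, pow_succ, hab, one_mul]
    exact_mod_cast congrArg Units.val h1
  have hτδ : τ ((a * b : Fˣ) : F) = ((a * b : Fˣ) : F) := by
    obtain ⟨z, hz⟩ := (mem_bot_iff_intCast p F).1 hδ
    rw [← hz, map_intCast]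
  have hτb : τ (b : F) = (b : F) ^ 2 := by
    have ha : (a : F) ≠ 0 := a.ne_zero
    have hb : (b : F) ≠ 0 := b.ne_zero
    rw [Units.val_mul, map_mul, hτ, Units.val_mul, Units.val_inv_eq_inv_val] at hτδ
    field_simp at hτδ
    exact hτδ
  let T : F ≃ₐ[ZMod p] F := AlgEquiv.ofRingEquiv (f := τ) fun x => by
    obtain ⟨z, rfl⟩ := ZMod.intCast_surjective x
    simp
  have hT : T ^ f = 1 := by
    have h1 : Nat.card (F ≃ₐ[ZMod p] F) = f := by
      rw [IsGalois.card_aut_eq_finrank]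
      have h2 := Module.natCard_eq_pow_finrank (K := ZMod p) (V := F)
      rw [hf, Nat.card_zmod] at h2
      exact (Nat.pow_right_injective hp.two_le h2).symm
    rw [← h1]
    exact pow_card_eq_one'
  have hiter : ∀ i : ℕ, (T ^ i) (b : F) = (b : F) ^ 2 ^ i := by
    intro i
    induction i with
    | zero => simp
    | succ i ih =>
      rw [pow_succ, AlgEquiv.mul_apply, show T (b : F) = (b : F) ^ 2 from hτb, map_pow, ih,
        ← pow_mul, pow_succ]
  have hb : b ^ 2 ^ f = b := by
    ext
    rw [Units.val_pow_eq_pow_val, ← hiter, hT, AlgEquiv.one_apply]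
  have hf0 : f ≠ 0 := by
    rintro rfl
    rw [pow_zero] at hf
    exact absurd hf Finite.one_lt_card.ne'
  have h2f : 1 < 2 ^ f := Nat.one_lt_two_pow hf0
  have hone : b ^ (2 ^ f - 1) = 1 := by
    have : b ^ (2 ^ f - 1) * b = 1 * b := by
      rw [← pow_succ, Nat.sub_add_cancel h2f.le, hb, one_mul]
    exact mul_right_cancel this
  exact (orderOf_le_of_pow_eq_one (by omega) hone).trans (Nat.sub_le _ _)

/-! ### Torsion modules in coordinates -/

namespace AbelianVariety

variable {k : Type u} [Field k] {A : AbelianVariety k} {E : Type v} [Field E]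
  {φ : E →+* EndRing A ⊗[ℤ] ℚ} {I J P : Ideal (𝓞 E)}

/-- The order `R` surjects onto `𝓞 E ⧸ I`. -/
def OrderSurjects (φ : E →+* EndRing A ⊗[ℤ] ℚ) (I : Ideal (𝓞 E)) : Prop :=
  ∀ α : 𝓞 E, ∃ (r : 𝓞 E) (f : EndRing A), Represents φ f r ∧
    Ideal.Quotient.mk I r = Ideal.Quotient.mk I α

theorem OrderSurjects.mono (h : OrderSurjects φ I) (hIJ : I ≤ J) : OrderSurjects φ J := by
  intro α
  obtain ⟨r, f, hf, hr⟩ := h α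
  exact ⟨r, f, hf, Ideal.Quotient.eq.2 (hIJ (Ideal.Quotient.eq.1 hr))⟩

theorem IsGoodPrime.orderSurjects {p : ℕ} [hp : Fact p.Prime] (hgood : IsGoodPrime φ p) {n : ℕ}
    (hI : (p : 𝓞 E) ^ n ∈ I) : OrderSurjects φ I := by
  intro α
  set m := (endOrder φ).toAddSubgroup.index with hm
  have hmα : m • α ∈ (endOrder φ).toAddSubgroup := AddSubgroup.nsmul_index_mem _ α
  have hcop : IsCoprime (m : ℤ) ((p ^ n : ℕ) : ℤ) := by
    rw [Nat.isCoprime_iff_coprime]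
    exact ((hp.out.coprime_iff_not_dvd.2 hgood).symm).pow_right n
  obtain ⟨x, y, hxy⟩ := hcop
  obtain ⟨f, hf⟩ : x • m • α ∈ endOrder φ := (endOrder φ).toAddSubgroup.zsmul_mem hmα x
  refine ⟨x • m • α, f, hf.symm, Ideal.Quotient.eq.2 ?_⟩
  have h1 : (x : 𝓞 E) * m + y * p ^ n = 1 := by
    have := congrArg (Int.cast : ℤ → 𝓞 E) hxy
    push_cast at this
    exact this
  have h2 : x • m • α - α = (-(y : 𝓞 E) * α) * p ^ n := by
    rw [zsmul_eq_mul, nsmul_eq_mul]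
    linear_combination α * h1
  rw [h2]
  exact I.mul_mem_left _ hI

theorem Represents.mul {f f' : EndRing A} {r r' : 𝓞 E} (h : Represents φ f r)
    (h' : Represents φ f' r') : Represents φ (f * f') (r * r') := by
  rw [Represents, map_mul, map_mul, h, h', Algebra.TensorProduct.tmul_mul_tmul, one_mul]

theorem onPoints_mem_torsion {f : EndRing A} {r : 𝓞 E} (h : Represents φ f r) {x : A.Points}
    (hx : x ∈ torsion φ I) : f.onPoints x ∈ torsion φ I := by
  intro α hα f' hf'
  have hmul : f'.onPoints (f.onPoints x) = (f' * f).onPoints x :=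
    CategoryTheory.Category.assoc (Additive.toMul x : geomPt k ⟶ A.X) f.hom f'.hom
  rw [hmul]
  exact hx _ (I.mul_mem_right r hα) _ (hf'.mul h)

/-- An additive map of `A[I]` that commutes with the elements of the order `R` is given by a matrix
in each pair of bases. -/
theorem exists_matrix_of_commute (hI : OrderSurjects φ I) (b b' : TorsionBasis φ I)
    (s : torsion φ I →+ torsion φ I)
    (hs : ∀ (f : EndRing A) (r : 𝓞 E), Represents φ f r → ∀ x y : torsion φ I,
      (y : A.Points) = f.onPoints x → (s y : A.Points) = f.onPoints (s x)) :
    ∃ T : Matrix (Fin 2) (Fin 2) (𝓞 E ⧸ I), ∀ x, b'.coord (s x) = T.mulVec (b.coord x) := by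
  let L : (Fin 2 → 𝓞 E ⧸ I) →ₗ[𝓞 E ⧸ I] (Fin 2 → 𝓞 E ⧸ I) :=
    { toFun := fun w => b'.coord (s (b.coord.symm w))
      map_add' := fun w w' => by rw [map_add, map_add, map_add]
      map_smul' := fun c w => by
        obtain ⟨α, rfl⟩ := Ideal.Quotient.mk_surjective c
        obtain ⟨r, f, hf, hr⟩ := hI α
        set x := b.coord.symm w with hx
        let y : torsion φ I := ⟨f.onPoints x, onPoints_mem_torsion hf x.2⟩
        have hy : b.coord.symm (Ideal.Quotient.mk I α • w) = y := by
          rw [AddEquiv.symm_apply_eq, b.map_act r f hf x y rfl, hx, AddEquiv.apply_symm_apply, hr]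
        rw [hy, b'.map_act r f hf (s x) (s y) (hs f r hf x y rfl), hr]
        rfl }
  refine ⟨LinearMap.toMatrix' L, fun x => ?_⟩
  rw [LinearMap.toMatrix'_mulVec]
  exact congrArg (fun z => b'.coord (s z)) (b.coord.symm_apply_apply x).symm

/-- The action of `σ` on `A[I]`. -/
noncomputable abbrev galAut (φ : E →+* EndRing A ⊗[ℤ] ℚ) (I : Ideal (𝓞 E))
    (σ : Gal(AlgebraicClosure k/k)) :
    torsion φ I ≃ₗ[ℤ] torsion φ I :=
  DistribMulAction.toModuleAut ℤ (torsion φ I) σ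

theorem TorsionBasis.matrix_mulVec (hI : OrderSurjects φ I) (b : TorsionBasis φ I)
    (σ : Gal(AlgebraicClosure k/k)) (x : torsion φ I) :
    (b.matrix (galAut φ I σ)).mulVec (b.coord x) = b.coord (σ • x) := by
  obtain ⟨T, hT⟩ := exists_matrix_of_commute hI b b
    (DistribSMul.toAddMonoidHom (torsion φ I) σ) (fun f r _ x y hxy => by
      change σ • (y : A.Points) = f.onPoints (σ • (x : A.Points))
      rw [onPoints_smul, hxy])
  have hbT : b.matrix (galAut φ I σ) = T := by
    ext r c
    change b.coord (DistribSMul.toAddMonoidHom (torsion φ I) σ (b.coord.symm (Pi.single c 1))) r = _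
    rw [hT, AddEquiv.apply_symm_apply]
    simp
  rw [hbT]
  exact (hT x).symm

theorem TorsionBasis.matrix_eq (b : TorsionBasis φ I) (σ : Gal(AlgebraicClosure k/k))
    {T : Matrix (Fin 2) (Fin 2) (𝓞 E ⧸ I)} (hT : ∀ x, b.coord (σ • x) = T.mulVec (b.coord x)) :
    b.matrix (galAut φ I σ) = T := by
  ext r c
  change b.coord (σ • (b.coord.symm (Pi.single c 1))) r = _
  rw [hT, AddEquiv.apply_symm_apply]
  simp

/-- The representation of the absolute Galois group on `A[I]` in a basis. -/
noncomputable def TorsionBasis.galRep (hI : OrderSurjects φ I) (b : TorsionBasis φ I) :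
    Gal(AlgebraicClosure k/k) →* Matrix (Fin 2) (Fin 2) (𝓞 E ⧸ I) where
  toFun σ := b.matrix (galAut φ I σ)
  map_one' := b.matrix_eq 1 fun x => by rw [one_smul, Matrix.one_mulVec]
  map_mul' σ τ := b.matrix_eq (σ * τ) fun x => by
    rw [← Matrix.mulVec_mulVec, b.matrix_mulVec hI, b.matrix_mulVec hI, mul_smul]

theorem TorsionBasis.charpoly_matrix_eq (hI : OrderSurjects φ I) (b b' : TorsionBasis φ I)
    (σ : Gal(AlgebraicClosure k/k)) :
    (b.matrix (galAut φ I σ)).charpoly = (b'.matrix (galAut φ I σ)).charpoly := by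
  obtain ⟨T, hT⟩ := exists_matrix_of_commute hI b b' (AddMonoidHom.id _) fun f r _ x y h => h
  obtain ⟨T', hT'⟩ := exists_matrix_of_commute hI b' b (AddMonoidHom.id _) fun f r _ x y h => h
  simp only [AddMonoidHom.id_apply] at hT hT'
  have h2 : T' * T = 1 := by
    refine Matrix.ext_of_mulVec_single fun i => ?_
    obtain ⟨x, hx⟩ := b.coord.surjective (Pi.single i 1)
    rw [← hx, ← Matrix.mulVec_mulVec, ← hT, ← hT', Matrix.one_mulVec]
  have h3 : b'.matrix (galAut φ I σ) = T * b.matrix (galAut φ I σ) * T' :=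
    b'.matrix_eq σ fun x => by
      rw [← Matrix.mulVec_mulVec, ← Matrix.mulVec_mulVec, ← hT', b.matrix_mulVec hI, ← hT]
  rw [h3, Matrix.charpoly_mul_comm, ← mul_assoc, h2, one_mul]

/-- Let `π` be an element with `(Q : π) = P`. Multiplication by `π` identifies the reduction of
`A[Q]` modulo `P` with `A[P]`; so a basis of `A[Q]` induces a basis of `A[P]` in which the matrices
of the Galois group are the reductions. -/
theorem exists_reduction_basis [NumberField E] (hP : P ≠ ⊥) {Q : Ideal (𝓞 E)}
    (hQ : OrderSurjects φ Q) (b : TorsionBasis φ Q) (b₁ : TorsionBasis φ P) (hle : Q ≤ P)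
    {π : 𝓞 E} (hπ : ∀ β, π * β ∈ Q ↔ β ∈ P) :
    ∃ b' : TorsionBasis φ P, ∀ σ : Gal(AlgebraicClosure k/k), b'.matrix (galAut φ P σ) =
      (Ideal.Quotient.factor hle).mapMatrix (b.matrix (galAut φ Q σ)) := by
  set red := Ideal.Quotient.factor hle with hred
  have hredsurj : Function.Surjective red := Ideal.Quotient.factor_surjective hle
  -- The point with coordinates `π w`, which lies in `A[P]`.
  let θ : (Fin 2 → 𝓞 E ⧸ Q) → torsion φ Q := fun w => b.coord.symm (Ideal.Quotient.mk Q π • w)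
  have hθP : ∀ w, (θ w : A.Points) ∈ torsion φ P := by
    intro w α hα f hf
    let y : torsion φ Q := ⟨f.onPoints (θ w), onPoints_mem_torsion hf (θ w).2⟩
    have h1 : b.coord y = 0 := by
      rw [b.map_act α f hf (θ w) y rfl, AddEquiv.apply_symm_apply, smul_smul, ← map_mul,
        mul_comm, Ideal.Quotient.eq_zero_iff_mem.2 ((hπ α).2 hα), zero_smul]
    have h2 : y = 0 := b.coord.injective (by rw [h1, map_zero])
    exact congrArg Subtype.val h2
  have hker : ∀ w : Fin 2 → 𝓞 E ⧸ Q, Ideal.Quotient.mk Q π • w = 0 ↔ red ∘ w = 0 := by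
    intro w
    rw [funext_iff, funext_iff]
    refine forall_congr' fun i => ?_
    obtain ⟨β, hβ⟩ := Ideal.Quotient.mk_surjective (w i)
    rw [Pi.smul_apply, Function.comp_apply, ← hβ, smul_eq_mul, ← map_mul, hred,
      Ideal.Quotient.factor_mk, Pi.zero_apply, Pi.zero_apply, Ideal.Quotient.eq_zero_iff_mem,
      Ideal.Quotient.eq_zero_iff_mem, hπ]
  obtain ⟨sec, hsec⟩ : ∃ sec : (Fin 2 → 𝓞 E ⧸ P) → (Fin 2 → 𝓞 E ⧸ Q), ∀ v, red ∘ sec v = v :=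
    (hredsurj.comp_left (α := Fin 2)).hasRightInverse
  have hθeq : ∀ w w' : Fin 2 → 𝓞 E ⧸ Q, red ∘ w = red ∘ w' → θ w = θ w' := by
    intro w w' h
    have : Ideal.Quotient.mk Q π • (w - w') = 0 := (hker _).2 (by
      funext i
      have := congrFun h i
      simpa [sub_eq_zero] using this)
    rw [smul_sub, sub_eq_zero] at this
    exact congrArg b.coord.symm this
  let ψ : (Fin 2 → 𝓞 E ⧸ P) →+ torsion φ P :=
    { toFun := fun v => ⟨θ (sec v), hθP _⟩
      map_zero' := Subtype.ext (by
        change ((θ (sec 0) : torsion φ Q) : A.Points) = 0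
        rw [hθeq (sec 0) 0 (by rw [hsec]; funext i; simp)]
        simp [θ])
      map_add' := fun v v' => Subtype.ext (by
        change ((θ (sec (v + v')) : torsion φ Q) : A.Points) = (θ (sec v) : A.Points) + θ (sec v')
        rw [hθeq (sec (v + v')) (sec v + sec v') (by
          rw [hsec]; funext i
          have h1 := congrFun (hsec v) i
          have h2 := congrFun (hsec v') i
          simp only [Function.comp_apply] at h1 h2
          simp [h1, h2])]
        simp [θ, smul_add]) }
  have hψ : ∀ w : Fin 2 → 𝓞 E ⧸ Q, (ψ (red ∘ w) : A.Points) = θ w := fun w => by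
    change ((θ (sec (red ∘ w)) : torsion φ Q) : A.Points) = θ w
    rw [hθeq (sec (red ∘ w)) w (hsec _)]
  have hψinj : Function.Injective ψ := by
    rw [injective_iff_map_eq_zero]
    intro v hv
    have h1 : θ (sec v) = 0 := by
      have := congrArg Subtype.val hv
      exact Subtype.ext this
    have h2 : Ideal.Quotient.mk Q π • sec v = 0 := by
      simpa [θ] using h1
    rw [← hsec v]
    exact (hker _).1 h2
  have := Ideal.finiteQuotientOfFreeOfNeBot P hP
  have : Finite (torsion φ P) := Finite.of_equiv _ b₁.coord.symm.toEquiv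
  have hψbij : Function.Bijective ψ :=
    hψinj.bijective_of_nat_card_le (Nat.card_congr b₁.coord.toEquiv).le
  let ψe := AddEquiv.ofBijective ψ hψbij
  have hlift : ∀ x : torsion φ P, ∃ w : Fin 2 → 𝓞 E ⧸ Q, ψe.symm x = red ∘ w ∧
      (x : A.Points) = θ w := by
    intro x
    refine ⟨sec (ψe.symm x), (hsec _).symm, ?_⟩
    rw [← hψ, hsec]
    exact congrArg Subtype.val (ψe.apply_symm_apply x).symm
  refine ⟨⟨ψe.symm, fun r f hf x y hxy => ?_⟩, fun σ => ?_⟩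
  · obtain ⟨w, hw, hxw⟩ := hlift x
    rw [AddEquiv.symm_apply_eq, hw]
    have h1 : Ideal.Quotient.mk P r • (red ∘ w) = red ∘ (Ideal.Quotient.mk Q r • w) := by
      funext i
      simp [red, Ideal.Quotient.factor_mk]
    refine Subtype.ext ?_
    rw [h1]
    change (y : A.Points) = ψ (red ∘ (Ideal.Quotient.mk Q r • w))
    rw [hψ, hxy, hxw]
    let z : torsion φ Q := ⟨f.onPoints (θ w), onPoints_mem_torsion hf (θ w).2⟩
    change ((z : torsion φ Q) : A.Points) = _
    congr 1
    rw [AddEquiv.eq_symm_apply, b.map_act r f hf (θ w) z rfl, AddEquiv.apply_symm_apply,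
      smul_comm]
  · refine TorsionBasis.matrix_eq _ σ fun x => ?_
    obtain ⟨w, hw, hxw⟩ := hlift x
    change ψe.symm (σ • x) = Matrix.mulVec _ (ψe.symm x)
    set B := b.matrix (galAut φ Q σ) with hB
    have h1 : (red.mapMatrix B).mulVec (red ∘ w) = red ∘ B.mulVec w := by
      funext i
      exact (red.map_mulVec B w i).symm
    rw [AddEquiv.symm_apply_eq, hw, h1]
    refine Subtype.ext ?_
    change σ • (x : A.Points) = ψ (red ∘ B.mulVec w)
    rw [hψ, hxw]
    change ((σ • θ w : torsion φ Q) : A.Points) = _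
    congr 1
    rw [AddEquiv.eq_symm_apply, ← b.matrix_mulVec hQ, AddEquiv.apply_symm_apply,
      Matrix.mulVec_smul]

end AbelianVariety

/-! ### Local cohomology of the torsion of an abelian variety -/

namespace AbelianVariety

variable {k : Type u} [Field k] {A : AbelianVariety k} {E : Type v} [Field E]
  {φ : E →+* EndRing A ⊗[ℤ] ℚ}

/-- A group that acts through its image in the automorphism group has the same locally trivial
classes as its image. -/
theorem subsingleton_H1loc_galImage {I : Ideal (𝓞 E)}
    (h : locCocycles Gal(AlgebraicClosure k/k) (torsion φ I) ≤
      oneCoboundaries Gal(AlgebraicClosure k/k) (torsion φ I)) :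
    Subsingleton (H1loc (galImage φ I) (torsion φ I)) := by
  rw [QuotientAddGroup.subsingleton_iff]
  rw [AddSubgroup.addSubgroupOf_eq_top]
  intro Z hZ
  let r : Gal(AlgebraicClosure k/k) →* galImage φ I :=
    (DistribMulAction.toModuleAut ℤ (torsion φ I)).rangeRestrict
  have hr : Function.Surjective r := MonoidHom.rangeRestrict_surjective _
  have hY : (fun σ => Z (r σ)) ∈ locCocycles Gal(AlgebraicClosure k/k) (torsion φ I) :=
    ⟨fun s t => (congrArg Z (map_mul r s t)).trans (hZ.1 (r s) (r t)), fun s => hZ.2 (r s)⟩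
  obtain ⟨m, hm⟩ := h hY
  refine ⟨m, fun s => ?_⟩
  obtain ⟨σ, rfl⟩ := hr s
  exact hm σ

/-- The first local cohomology group of `A[P ^ n]` vanishes if the eigenvalues of `g` differ from
`1`, the first one is not conjugate to `l₁ / l₂`, and the second one is not conjugate to
`l₂ / l₁`. -/
theorem subsingleton_H1loc_torsion_pow [NumberField E] {p : ℕ} [hp : Fact p.Prime]
    (hgood : IsGoodPrime φ p) {P : Ideal (𝓞 E)} [P.IsPrime] (hpP : (p : 𝓞 E) ∈ P) {n : ℕ}
    (bn : TorsionBasis φ (P ^ n)) (g : galImage φ P) (hg : IsBorelGenerator φ p P g)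
    {l₁ l₂ : (𝓞 E ⧸ P)ˣ} (heig : HasEigenvalues g.1 (l₁ : 𝓞 E ⧸ P) (l₂ : 𝓞 E ⧸ P))
    (h₁ : l₁ ≠ 1) (h₂ : l₂ ≠ 1) (h₁₂ : ¬ IsGaloisConj (l₁ : 𝓞 E ⧸ P) ↑(l₁ * l₂⁻¹))
    (h₂₁ : ¬ IsGaloisConj (l₂ : 𝓞 E ⧸ P) ↑(l₂ * l₁⁻¹)) :
    Subsingleton (H1loc (galImage φ (P ^ n)) (torsion φ (P ^ n))) := by
  have hP0 : P ≠ ⊥ := by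
    rintro rfl
    rw [Ideal.mem_bot, Nat.cast_eq_zero] at hpP
    exact hp.out.ne_zero hpP
  have hmax : P.IsMaximal := Ideal.isMaximal_of_isPrime_of_ne_bot P hP0
  refine subsingleton_H1loc_galImage ?_
  obtain _ | n := n
  -- The module `A[P ^ 0]` is trivial.
  · have hsub : Subsingleton (𝓞 E ⧸ P ^ 0) := by
      rw [pow_zero, Ideal.one_eq_top]; exact Ideal.Quotient.subsingleton_iff.2 rfl
    have : Subsingleton (torsion φ (P ^ 0)) := bn.coord.toEquiv.subsingleton
    exact fun Z _ => ⟨0, fun s => Subsingleton.elim _ _⟩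
  have hPn : OrderSurjects φ (P ^ (n + 1)) := hgood.orderSurjects (Ideal.pow_mem_pow hpP _)
  have hle : P ^ (n + 1) ≤ P := Ideal.pow_le_self n.succ_ne_zero
  have hP1 : OrderSurjects φ P := hPn.mono hle
  obtain ⟨b₁, hb₁⟩ := heig
  obtain ⟨π, hπ, hπ'⟩ := Ideal.exists_mem_pow_notMem_pow_succ P hP0 hmax.ne_top n
  have hπP : ∀ β, π * β ∈ P ^ (n + 1) ↔ β ∈ P := fun β =>
    ⟨fun h => (Ideal.IsPrime.mul_mem_pow P (mul_comm π β ▸ h)).resolve_right hπ',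
      fun h => by rw [pow_succ]; exact Ideal.mul_mem_mul hπ h⟩
  obtain ⟨b, hb⟩ := exists_reduction_basis hP0 hPn bn b₁ hle hπP
  let _ := Ideal.Quotient.field P
  have : Finite (𝓞 E ⧸ P) := Ideal.finiteQuotientOfFreeOfNeBot P hP0
  have hchar0 : ((p : ℕ) : 𝓞 E ⧸ P) = 0 := by
    rw [← map_natCast (Ideal.Quotient.mk P)]
    exact Ideal.Quotient.eq_zero_iff_mem.2 hpP
  have : CharP (𝓞 E ⧸ P) p := (CharP.charP_iff_prime_eq_zero hp.out).2 hchar0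
  have : Finite (torsion φ P) := Finite.of_equiv _ b.coord.symm.toEquiv
  have : Finite (torsion φ P ≃ₗ[ℤ] torsion φ P) :=
    Finite.of_injective (fun s => (s : torsion φ P → torsion φ P)) DFunLike.coe_injective
  let red : 𝓞 E ⧸ P ^ (n + 1) →+* 𝓞 E ⧸ P := Ideal.Quotient.factor hle
  have hred : Function.Surjective red := Ideal.Quotient.factor_surjective hle
  have hker : RingHom.ker red ^ (n + 1) = ⊥ := by
    rw [show RingHom.ker red = P.map (Ideal.Quotient.mk (P ^ (n + 1))) from
      Ideal.Quotient.factor_ker hle, ← Ideal.map_pow, Ideal.map_quotient_self]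
  let r : Gal(AlgebraicClosure k/k) →* galImage φ P :=
    (DistribMulAction.toModuleAut ℤ (torsion φ P)).rangeRestrict
  have hr : Function.Surjective r := MonoidHom.rangeRestrict_surjective _
  obtain ⟨σ, rfl⟩ := hr g
  obtain ⟨N⟩ : Nonempty (Sylow p (galImage φ P)) := inferInstance
  have : Subsingleton (Sylow p (galImage φ P)) := ⟨hg.unique_sylow⟩
  have hNnormal : (N : Subgroup (galImage φ P)).Normal := N.normal_of_subsingleton
  -- The residual representation factors through the image of the Galois group.
  have hone : ∀ τ, r τ = 1 → b.galRep hP1 τ = 1 := by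
    intro τ hτ
    refine b.matrix_eq τ fun x => ?_
    have h3 : τ • x = x := congrArg (fun s : galImage φ P => s.1 x) hτ
    rw [h3, Matrix.one_mulVec]
  have hredρ : ∀ τ, red.mapMatrix (bn.galRep hPn τ) = b.galRep hP1 τ := fun τ => (hb τ).symm
  have hσpow : r σ ^ (Nat.card (𝓞 E ⧸ P) - 1) = 1 := orderOf_dvd_iff_pow_eq_one.1 hg.orderOf_dvd
  refine locCocycles_le_oneCoboundaries_of_residual p (e := bn.coord) (ρ := bn.galRep hPn)
    (N := (N : Subgroup (galImage φ P)).comap r) (σ := σ) (l₁ := l₁) (l₂ := l₂) red hred hker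
    (fun s m => (bn.matrix_mulVec hPn s m).symm) (hNnormal.comap r) ?_ ?_ ?_ ?_ ?_ ?_ ?_ ?_ ?_ ?_
    ?_ ?_
  -- `N` contains the kernel of `r`.
  · rw [eq_top_iff]
    intro τ _
    have hτ : r τ ∈ (N : Subgroup (galImage φ P)) ⊔ Subgroup.zpowers (r σ) := by
      rw [hg.generates N]; trivial
    obtain ⟨x, hx, y, ⟨i, rfl⟩, hxy⟩ := Subgroup.mem_sup_of_normal_left.1 hτ
    have h3 : τ = τ * (σ ^ i)⁻¹ * σ ^ i := by rw [inv_mul_cancel_right]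
    rw [h3]
    refine mul_mem (Subgroup.mem_sup_left ?_) (Subgroup.mem_sup_right ⟨i, rfl⟩)
    rw [Subgroup.mem_comap, map_mul, map_inv, map_zpow, ← hxy, mul_inv_cancel_right]
    exact hx
  · rw [Subgroup.mem_comap, map_pow, hσpow]
    exact one_mem _
  · rw [hredρ, ← map_pow]
    exact hone _ (by rw [map_pow, hσpow])
  · intro τ hτ
    obtain ⟨j, hj⟩ := N.isPGroup' ⟨r τ, hτ⟩
    refine ⟨j, ?_⟩
    rw [hredρ, ← map_pow]
    refine hone _ ?_
    rw [map_pow]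
    exact congrArg Subtype.val hj
  -- A `p`-group acting on the nonzero group `A[P]` of `p`-power order has a nonzero fixed point.
  · have hdvd : p ∣ Nat.card (torsion φ P) := by
      have := Fintype.ofFinite (𝓞 E ⧸ P)
      rw [Nat.card_congr b.coord.toEquiv, Nat.card_fun, Nat.card_eq_fintype_card (α := 𝓞 E ⧸ P)]
      refine dvd_pow ?_ (by simp)
      rw [← CharP.cast_eq_zero_iff (𝓞 E ⧸ P) p]
      exact FiniteField.cast_card_eq_zero _
    obtain ⟨x, hx, hx0⟩ := N.isPGroup'.exists_fixed_point_of_prime_dvd_card_of_fixed_point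
      (torsion φ P) hdvd (a := 0) (fun s => smul_zero s)
    refine ⟨b.coord x, fun h => hx0 ?_, fun τ hτ => ?_⟩
    · exact (b.coord.map_eq_zero_iff.1 h).symm
    · rw [hredρ]
      refine (b.matrix_mulVec hP1 τ x).trans ?_
      have h3 : τ • x = x := hx ⟨r τ, hτ⟩
      rw [h3]
  · exact l₁.ne_zero
  · exact l₂.ne_zero
  · rw [hredρ, ← hb₁]
    exact b.charpoly_matrix_eq hP1 b₁ σ
  · exact fun h => h₁ (Units.ext h)
  · exact fun h => h₂ (Units.ext h)
  · rwa [Units.val_mul, Units.val_inv_eq_inv_val] at h₁₂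
  · rwa [Units.val_mul, Units.val_inv_eq_inv_val] at h₂₁

/-- The product of the eigenvalues is the determinant. -/
theorem HasEigenvalues.mul_eq_det {I : Ideal (𝓞 E)} (hI : OrderSurjects φ I) {s : galImage φ I}
    {l₁ l₂ δ : 𝓞 E ⧸ I} (hs : HasEigenvalues s.1 l₁ l₂) (hδ : HasDet s.1 δ) : l₁ * l₂ = δ := by
  obtain ⟨b, hb⟩ := hs
  obtain ⟨b', rfl⟩ := hδ
  obtain ⟨_, σ, rfl⟩ := s
  have h1 := b.charpoly_matrix_eq hI b' σ
  rw [Matrix.det_eq_sign_charpoly_coeff]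
  change _ = _ * (b'.matrix (galAut φ I σ)).charpoly.coeff 0
  rw [← h1, show (b.matrix (galAut φ I σ)).charpoly = _ from hb]
  simp [Polynomial.mul_coeff_zero]

end AbelianVariety

/-- The residue field of a prime over `p` has degree at most `[E : ℚ]`. -/
theorem exists_card_quotient_eq_pow {E : Type*} [Field E] [NumberField E] {p : ℕ}
    (hp : p.Prime) {P : Ideal (𝓞 E)} (hpP : (p : 𝓞 E) ∈ P) :
    ∃ f ≤ Module.finrank ℚ E, Nat.card (𝓞 E ⧸ P) = p ^ f := by
  have h1 : Ideal.absNorm P ∣ Ideal.absNorm (Ideal.span {(p : 𝓞 E)}) :=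
    Ideal.absNorm_dvd_absNorm_of_le ((Ideal.span_singleton_le_iff_mem P).2 hpP)
  have h2 : Ideal.absNorm (Ideal.span {(p : 𝓞 E)}) = p ^ Module.finrank ℚ E := by
    rw [Ideal.absNorm_span_singleton, ← NumberField.RingOfIntegers.rank E]
    have := Algebra.norm_algebraMap (S := 𝓞 E) (p : ℤ)
    rw [map_natCast] at this
    rw [this, Int.natAbs_pow, Int.natAbs_natCast]
  rw [h2, Ideal.absNorm_apply, Submodule.cardQuot_apply] at h1
  exact (Nat.dvd_prime_pow hp).1 h1

theorem two_pow_le_bound {d f : ℕ} (hfd : f ≤ d) (hd : 1 ≤ d) :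
    ((2 ^ f : ℕ) : ℝ) ≤
      (2 : ℝ) ^ (((d : ℝ) + 1) ^ (2 * Real.log d / Real.log 2) + 1) := by
  have hd1 : (1 : ℝ) ≤ d := by exact_mod_cast hd
  have hbound : (f : ℝ) ≤ ((d : ℝ) + 1) ^ (2 * Real.log d / Real.log 2) + 1 := by
    have hfd' : (f : ℝ) ≤ d := by exact_mod_cast hfd
    have hpos : 0 ≤ ((d : ℝ) + 1) ^ (2 * Real.log d / Real.log 2) := by positivity
    rcases Nat.lt_or_ge d 2 with h | h
    · have : (d : ℝ) = 1 := by exact_mod_cast (by omega : d = 1)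
      linarith
    · have h2 : (2 : ℝ) ≤ d := by exact_mod_cast h
      have hlog2 : 0 < Real.log 2 := Real.log_pos one_lt_two
      have hlog : Real.log 2 ≤ Real.log d := Real.log_le_log two_pos h2
      have hexp : 1 ≤ 2 * Real.log d / Real.log 2 := by
        rw [le_div_iff₀ hlog2]; linarith
      have := Real.self_le_rpow_of_one_le (by linarith : (1 : ℝ) ≤ d + 1) hexp
      linarith
  have := Real.rpow_le_rpow_of_exponent_le one_le_two hbound
  rw [Real.rpow_natCast] at this
  exact_mod_cast this

theorem corollary17 {k : Type u} [Field k] [NumberField k] {E : Type v} [Field E] [NumberField E]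
    (A : AbelianVariety k) (hdim : topologicalKrullDim A.X.left = Module.finrank ℚ E)
    (φ : E →+* A.EndRing ⊗[ℤ] ℚ)
    (p : ℕ) [Fact p.Prime] (hgood : AbelianVariety.IsGoodPrime φ p)
    (hunram : ∀ Q : Ideal (𝓞 E), Q.IsPrime → Q.LiesOver (Ideal.span {(p : ℤ)}) →
      Q.ramificationIdx ℤ = 1)
    (P : Ideal (𝓞 E)) [P.IsPrime] [P.LiesOver (Ideal.span {(p : ℤ)})]
    (hdet : AbelianVariety.DetIsCyclotomic φ p P)
    (n : ℕ) (hloc : Nontrivial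
      (H1loc (AbelianVariety.galImage φ (P ^ n)) (AbelianVariety.torsion φ (P ^ n))))
    (g : AbelianVariety.galImage φ P) (hg : AbelianVariety.IsBorelGenerator φ p P g)
    (l₁ l₂ : (𝓞 E ⧸ P)ˣ)
    (heig : AbelianVariety.HasEigenvalues g.1
      (l₁ : 𝓞 E ⧸ P) (l₂ : 𝓞 E ⧸ P))
    (h₁ : l₁ ≠ 1) (h₂ : l₂ ≠ 1) (hp : 3 * Module.finrank ℚ E + 1 ≤ p) :
    (IsGaloisConj (l₁ : 𝓞 E ⧸ P) ↑(l₁ * l₂⁻¹) ∨ IsGaloisConj (l₁ : 𝓞 E ⧸ P) ↑(l₂ * l₁⁻¹) ∨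
      IsGaloisConj (l₂ : 𝓞 E ⧸ P) ↑(l₁ * l₂⁻¹) ∨ IsGaloisConj (l₂ : 𝓞 E ⧸ P) ↑(l₂ * l₁⁻¹)) ∧
    ((orderOf l₁ : ℝ) ≤ (2 : ℝ) ^ (((Module.finrank ℚ E : ℝ) + 1) ^
        (2 * Real.log (Module.finrank ℚ E) / Real.log 2) + 1) ∨
      (orderOf l₂ : ℝ) ≤ (2 : ℝ) ^ (((Module.finrank ℚ E : ℝ) + 1) ^
        (2 * Real.log (Module.finrank ℚ E) / Real.log 2) + 1)) := by
  have hp' := (Fact.out : p.Prime)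
  have hpP : (p : 𝓞 E) ∈ P := by
    have h := (Ideal.mem_of_liesOver P (Ideal.span {(p : ℤ)}) (p : ℤ)).1
      (Ideal.mem_span_singleton_self _)
    simpa using h
  have hP0 : P ≠ ⊥ := by
    rintro rfl
    rw [Ideal.mem_bot, Nat.cast_eq_zero] at hpP
    exact hp'.ne_zero hpP
  have hmax : P.IsMaximal := Ideal.isMaximal_of_isPrime_of_ne_bot P hP0
  obtain ⟨f, hfd, hf⟩ := exists_card_quotient_eq_pow hp' hpP
  have hbound : ∀ {l : (𝓞 E ⧸ P)ˣ}, orderOf l ≤ 2 ^ f → (orderOf l : ℝ) ≤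
      (2 : ℝ) ^ (((Module.finrank ℚ E : ℝ) + 1) ^
        (2 * Real.log (Module.finrank ℚ E) / Real.log 2) + 1) := fun h =>
    (Nat.cast_le.2 h).trans (two_pow_le_bound hfd Module.finrank_pos)
  let _ := Ideal.Quotient.field P
  have : Finite (𝓞 E ⧸ P) := Ideal.finiteQuotientOfFreeOfNeBot P hP0
  have hchar0 : ((p : ℕ) : 𝓞 E ⧸ P) = 0 := by
    rw [← map_natCast (Ideal.Quotient.mk P)]
    exact Ideal.Quotient.eq_zero_iff_mem.2 hpP
  have : CharP (𝓞 E ⧸ P) p := (CharP.charP_iff_prime_eq_zero hp').2 hchar0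
  obtain ⟨δ, hδ, hδord⟩ := hg.orderOf_det
  have hprod : l₁ * l₂ = δ := Units.ext (heig.mul_eq_det
    (hgood.orderSurjects (n := 1) (by rwa [pow_one])) hδ)
  have hprodpow : (l₁ * l₂) ^ (p - 1) = 1 := by rw [hprod, ← hδord, pow_orderOf_eq_one]
  by_cases h₁₂ : IsGaloisConj (l₁ : 𝓞 E ⧸ P) ↑(l₁ * l₂⁻¹)
  · exact ⟨.inl h₁₂, .inr (hbound (orderOf_le_of_isGaloisConj p hf hprodpow h₁₂))⟩
  by_cases h₂₁ : IsGaloisConj (l₂ : 𝓞 E ⧸ P) ↑(l₂ * l₁⁻¹)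
  · rw [mul_comm] at hprodpow
    exact ⟨.inr (.inr (.inr h₂₁)), .inl (hbound (orderOf_le_of_isGaloisConj p hf hprodpow h₂₁))⟩
  obtain ⟨bn, -⟩ := hdet n 1
  have := AbelianVariety.subsingleton_H1loc_torsion_pow hgood hpP bn g hg heig h₁ h₂ h₁₂ h₂₁
  exact absurd hloc (not_nontrivial _)
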